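/- Let $R$ be an integral domain which is not a field and such that $R/(m)$ is finite for every $m\in R^\times:=R\setminus\{0\}$; let $Q(R)$ be its quotient field. Let $\mathfrak A[R]$ be the universal C*-algebra generated by isometries $s_m$ ($m\in R^\times$) and unitaries $u^n$ ($n\in R$) with the relations $s_ks_m=s_{km}$, $u^lu^n=u^{l+n}$, $s_mu^n=u^{mn}s_m$ and $\sum_{n+(m)\in R/(m)}u^ns_ms_m^*u^{-n}=1$ for all $k,m\in R^\times$, $l,n\in R$. Let $\mathfrak A(R)$ be the C*-inductive limit of the system $\{\mathfrak A(R)_m;\varphi_{m,lm}\}$ indexed by $R^\times$ ordered by divisibility, where $\mathfrak A(R)_m=\mathfrak A[R]$ and $\varphi_{m,lm}(x)=s_lxs_l^*$, and let $\omega_m:\mathfrak A[R]=\mathfrak A(R)_m\to\mathfrak A(R)$ be the canonical maps. Let $\hat R=\varprojlim_m R/(m)$ with the topology induced from the product of the finite discrete rings $R/(m)$, $m\in R^\times$, and let $\mathscr R=\varinjlim\{\mathscr R_m;\phi_{m,lm}\}$ with the inductive limit topology, where $\mathscr R_m=\hat R$ and $\phi_{m,lm}$ is multiplication by $l$; identify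 $\hat R$ with the compact open subset $\mathscr R_1$ of the ring $\mathscr R\supseteq Q(R)$, and let $p_{\hat R}\in C_0(\mathscr R)$ be its characteristic function. Let $P_{Q(R)}$ be the discrete group of matrices $\left(\begin{smallmatrix}a&b\\0&1\end{smallmatrix}\right)$ with $a\in Q(R)\setminus\{0\}$, $b\in Q(R)$, acting on $\mathscr R$ by the affine maps $x\mapsto ax+b$ and on $C_0(\mathscr R)$ by $(\alpha_gf)(x)=f(g^{-1}x)$, and let $C_0(\mathscr R)\rtimes P_{Q(R)}$ be the (full) crossed product, with implementing unitaries $V_g$, $V_gfV_g^*=\alpha_g(f)$. Then there are *-isomorphisms $$\Phi:\mathfrak A(R)\longrightarrow C_0(\mathscr R)\rtimes P_{Q(R)},\qquad \beta:\mathfrak A[R]\longrightarrow p_{\hat R}\bigl(C_0(\mathscr R)\rtimes P_{Q(R)}\bigr)p_{\hat R}$$ such that $\beta(u^n)=V_{\left(\begin{smallmatrix}1&n\\0&1\end{smallmatrix}\right)}p_{\hat R}$ for all $n\in R$, $\beta(s_m)=V_{\left(\begin{smallmatrix}m&0\\0&1\end{smallmatrix}\right)}p_{\hat R}$ for all $m\in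 R^\times$, and $$\Phi(\omega_k(x))=V_{\left(\begin{smallmatrix}k&0\\0&1\end{smallmatrix}\right)}^*\,\beta(x)\,V_{\left(\begin{smallmatrix}k&0\\0&1\end{smallmatrix}\right)}\qquad(k\in R^\times,\ x\in\mathfrak A[R]).$$ -/

import Mathlib

open scoped nonZeroDivisors ZeroAtInfty

namespace RingCStar

noncomputable section

/-! ### C⋆-seminorms and the C⋆-algebras they define -/

/-- A C⋆-seminorm on a complex ⋆-algebra. -/
structure CStarSeminorm (A : Type*) [NonUnitalRing A] [StarRing A] [Module ℂ A] where
  toSeminorm : Seminorm ℂ A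
  mul_le : ∀ a b, toSeminorm (a * b) ≤ toSeminorm a * toSeminorm b
  star_mul_self : ∀ a, toSeminorm (star a * a) = toSeminorm a ^ 2

namespace CStarSeminorm

variable {A : Type*} [NonUnitalRing A] [StarRing A] [Module ℂ A]

instance : CoeFun (CStarSeminorm A) (fun _ => A → ℝ) := ⟨fun q => q.toSeminorm⟩

variable (q : CStarSeminorm A)

theorem nonneg (a : A) : 0 ≤ q a := apply_nonneg q.toSeminorm a

theorem le_star (a : A) : q a ≤ q (star a) := by
  have h := q.star_mul_self a
  have h2 := q.mul_le (star a) a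
  have h3 := q.nonneg a
  have h4 := q.nonneg (star a)
  rcases h3.eq_or_lt with h0 | h0
  · rw [← h0]; exact h4
  · nlinarith

theorem star_eq (a : A) : q (star a) = q a :=
  le_antisymm (by simpa using q.le_star (star a)) (q.le_star a)

/-- A copy of `A`, carrying the topology of the seminorm `q`. -/
def Pre (_q : CStarSeminorm A) : Type _ := A

instance : NonUnitalRing q.Pre := inferInstanceAs (NonUnitalRing A)
instance : StarRing q.Pre := inferInstanceAs (StarRing A)
instance : Module ℂ q.Pre := inferInstanceAs (Module ℂ A)
instance [StarModule ℂ A] : StarModule ℂ q.Pre := inferInstanceAs (StarModule ℂ A)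
instance [IsScalarTower ℂ A A] : IsScalarTower ℂ q.Pre q.Pre :=
  inferInstanceAs (IsScalarTower ℂ A A)
instance [SMulCommClass ℂ A A] : SMulCommClass ℂ q.Pre q.Pre :=
  inferInstanceAs (SMulCommClass ℂ A A)

instance : NonUnitalSeminormedRing q.Pre where
  __ := AddGroupSeminorm.toSeminormedAddCommGroup (E := q.Pre) q.toSeminorm.toAddGroupSeminorm
  __ := (inferInstance : NonUnitalRing q.Pre)
  norm_mul_le a b := q.mul_le a b

instance : NormedSpace ℂ q.Pre where
  norm_smul_le c a := (map_smul_eq_mul q.toSeminorm c (a : A)).le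

instance : NormedStarGroup q.Pre where
  norm_star_le a := (q.star_eq (a : A)).le

/-- The Hausdorff completion of `A` with respect to the C⋆-seminorm `q`. -/
def Compl : Type _ := UniformSpace.Completion q.Pre

open UniformSpace Function

instance : NormedAddCommGroup q.Compl := inferInstanceAs (NormedAddCommGroup (Completion q.Pre))
instance : NormedSpace ℂ q.Compl := inferInstanceAs (NormedSpace ℂ (Completion q.Pre))
instance : CompleteSpace q.Compl := inferInstanceAs (CompleteSpace (Completion q.Pre))

/-- The canonical map from `A` to its completion. -/
def coe (a : A) : q.Compl := ((show q.Pre from a : q.Pre) : Completion q.Pre)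

theorem coe_add (a b : A) : q.coe (a + b) = q.coe a + q.coe b :=
  Completion.coe_add (α := q.Pre) a b

theorem coe_zero : q.coe 0 = 0 := rfl

theorem coe_smul (c : ℂ) (a : A) : q.coe (c • a) = c • q.coe a :=
  Completion.coe_smul (X := q.Pre) c a

theorem norm_coe (a : A) : ‖q.coe a‖ = q a := Completion.norm_coe (E := q.Pre) a

theorem isDenseInducing_coe : IsDenseInducing (fun a : q.Pre => (q.coe a : q.Compl)) :=
  Completion.isDenseInducing_coe (α := q.Pre)

theorem continuous_coe : Continuous (fun a : q.Pre => (q.coe a : q.Compl)) :=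
  Completion.continuous_coe q.Pre

theorem denseRange_coe : DenseRange (q.coe : A → q.Compl) :=
  q.isDenseInducing_coe.dense

instance : Mul q.Compl :=
  ⟨curry <| (q.isDenseInducing_coe.prodMap q.isDenseInducing_coe).extend
    (fun p : q.Pre × q.Pre => q.coe ((p.1 * p.2 : q.Pre) : A))⟩

theorem coe_mul (a b : A) : q.coe (a * b) = q.coe a * q.coe b :=
  ((q.isDenseInducing_coe.prodMap q.isDenseInducing_coe).extend_eq
    (q.continuous_coe.comp (continuous_mul (M := q.Pre))) ((a, b) : q.Pre × q.Pre)).symm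

instance : ContinuousMul q.Compl where
  continuous_mul := by
    let m : q.Pre →+ q.Pre →+ q.Compl :=
      (AddMonoidHom.mul : q.Pre →+ q.Pre →+ q.Pre).compr₂
        ⟨⟨fun a => q.coe a, q.coe_zero⟩, q.coe_add⟩
    have : Continuous fun p : q.Pre × q.Pre => m p.1 p.2 :=
      q.continuous_coe.comp continuous_mul
    let t : q.Pre →+ q.Compl := ⟨⟨fun a => q.coe a, q.coe_zero⟩, q.coe_add⟩
    have di : IsDenseInducing (t : q.Pre → q.Compl) := q.isDenseInducing_coe
    exact (di.extend_Z_bilin di this :)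

instance : Star q.Compl := ⟨Completion.map (star : q.Pre → q.Pre)⟩

theorem uniformContinuous_star_pre : UniformContinuous (star : q.Pre → q.Pre) :=
  star_isometry.uniformContinuous

theorem coe_star (a : A) : q.coe (star a) = star (q.coe a) :=
  (Completion.map_coe q.uniformContinuous_star_pre a).symm

theorem continuous_star_compl : Continuous (star : q.Compl → q.Compl) :=
  Completion.continuous_map

@[elab_as_elim]
theorem ind {P : q.Compl → Prop} (x : q.Compl) (hc : IsClosed {x | P x})
    (h : ∀ a : A, P (q.coe a)) : P x :=
  q.denseRange_coe.induction_on x hc h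

@[elab_as_elim]
theorem ind₂ {P : q.Compl → q.Compl → Prop} (x y : q.Compl)
    (hc : IsClosed {x : q.Compl × q.Compl | P x.1 x.2})
    (h : ∀ a b : A, P (q.coe a) (q.coe b)) : P x y :=
  Completion.induction_on₂ (α := q.Pre) (β := q.Pre) x y hc h

@[elab_as_elim]
theorem ind₃ {P : q.Compl → q.Compl → q.Compl → Prop} (x y z : q.Compl)
    (hc : IsClosed {x : q.Compl × q.Compl × q.Compl | P x.1 x.2.1 x.2.2})
    (h : ∀ a b c : A, P (q.coe a) (q.coe b) (q.coe c)) : P x y z :=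
  Completion.induction_on₃ (α := q.Pre) (β := q.Pre) (γ := q.Pre) x y z hc h

instance : NonUnitalNormedRing q.Compl where
  __ := (inferInstance : NormedAddCommGroup q.Compl)
  left_distrib x y z := q.ind₃ x y z (isClosed_eq (by fun_prop) (by fun_prop)) fun a b c => by
    simp only [← coe_add, ← coe_mul, mul_add]
  right_distrib x y z := q.ind₃ x y z (isClosed_eq (by fun_prop) (by fun_prop)) fun a b c => by
    simp only [← coe_add, ← coe_mul, add_mul]
  zero_mul x := q.ind x (isClosed_eq (by fun_prop) (by fun_prop)) fun a => by
    rw [← coe_zero, ← coe_mul, zero_mul]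
  mul_zero x := q.ind x (isClosed_eq (by fun_prop) (by fun_prop)) fun a => by
    rw [← coe_zero, ← coe_mul, mul_zero]
  mul_assoc x y z := q.ind₃ x y z (isClosed_eq (by fun_prop) (by fun_prop)) fun a b c => by
    simp only [← coe_mul, mul_assoc]
  norm_mul_le x y := q.ind₂ x y (isClosed_le (by fun_prop) (by fun_prop)) fun a b => by
    rw [← coe_mul, norm_coe, norm_coe, norm_coe]; exact q.mul_le a b

instance : StarRing q.Compl where
  star_involutive x := q.ind x
    (isClosed_eq (q.continuous_star_compl.comp q.continuous_star_compl) continuous_id) fun a => by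
      simp only [← coe_star, star_star]
  star_mul x y := q.ind₂ x y
    (isClosed_eq (q.continuous_star_compl.comp (by fun_prop))
      ((q.continuous_star_compl.comp continuous_snd).mul
        (q.continuous_star_compl.comp continuous_fst))) fun a b => by
      simp only [← coe_star, ← coe_mul, star_mul]
  star_add x y := q.ind₂ x y
    (isClosed_eq (q.continuous_star_compl.comp (by fun_prop))
      ((q.continuous_star_compl.comp continuous_fst).add
        (q.continuous_star_compl.comp continuous_snd))) fun a b => by
      simp only [← coe_star, ← coe_add, star_add]

instance : CStarRing q.Compl where
  norm_mul_self_le x := q.ind x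
    (isClosed_le (by fun_prop)
      (continuous_norm.comp ((q.continuous_star_compl.comp continuous_id).mul continuous_id)))
    fun a => by
      rw [← coe_star, ← coe_mul, norm_coe, norm_coe, q.star_mul_self, sq]

theorem coe_unit_mul {e : A} (he : ∀ a, e * a = a) (x : q.Compl) : q.coe e * x = x :=
  q.ind x (isClosed_eq (continuous_const.mul continuous_id) continuous_id) fun a => by
    rw [← coe_mul, he]

variable [StarModule ℂ A] [IsScalarTower ℂ A A] [SMulCommClass ℂ A A]

instance : IsScalarTower ℂ q.Compl q.Compl where
  smul_assoc c x y := by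
    change c • x * y = c • (x * y)
    refine q.ind₂ (P := fun x y => c • x * y = c • (x * y)) x y
      (isClosed_eq ((continuous_fst.const_smul c).mul continuous_snd)
        ((continuous_fst.mul continuous_snd).const_smul c)) fun a b => ?_
    rw [← coe_mul, ← coe_smul, ← coe_smul, ← coe_mul, smul_mul_assoc]

instance : SMulCommClass ℂ q.Compl q.Compl where
  smul_comm c x y := by
    change c • (x * y) = x * c • y
    refine q.ind₂ (P := fun x y => c • (x * y) = x * c • y) x y
      (isClosed_eq ((continuous_fst.mul continuous_snd).const_smul c)
        (continuous_fst.mul (continuous_snd.const_smul c))) fun a b => ?_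
    rw [← coe_mul, ← coe_smul, ← coe_smul, ← coe_mul, mul_smul_comm]

instance : StarModule ℂ q.Compl where
  star_smul c x := by
    refine q.ind (P := fun x => star (c • x) = star c • star x) x
      (isClosed_eq (q.continuous_star_compl.comp (continuous_const_smul c))
        (q.continuous_star_compl.const_smul (star c))) fun a => ?_
    rw [← coe_star, ← coe_smul, ← coe_smul, ← coe_star, star_smul]

/-- The completion of a ⋆-algebra with respect to a C⋆-seminorm is a C⋆-algebra. -/
instance : NonUnitalCStarAlgebra q.Compl where

/-- The canonical ⋆-homomorphism from `A` to its completion. -/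
def toCompl : A →⋆ₙₐ[ℂ] q.Compl where
  toFun := q.coe
  map_smul' := q.coe_smul
  map_zero' := q.coe_zero
  map_add' := q.coe_add
  map_mul' := q.coe_mul
  map_star' := q.coe_star

theorem le_norm {B : Type*} [NonUnitalCStarAlgebra B] (q : CStarSeminorm B) (b : B) :
    q b ≤ ‖b‖ := by
  have h := NonUnitalStarAlgHom.norm_apply_le q.toCompl b
  rwa [show q.toCompl b = q.coe b from rfl, norm_coe] at h

/-- The pull-back of a C⋆-seminorm along a ⋆-homomorphism. -/
def comap {B : Type*} [NonUnitalRing B] [StarRing B] [Module ℂ B]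
    (q : CStarSeminorm A) (φ : B →⋆ₙₐ[ℂ] A) : CStarSeminorm B where
  toSeminorm := q.toSeminorm.comp (φ : B →ₗ[ℂ] A)
  mul_le a b := by
    have := q.mul_le (φ a) (φ b)
    simpa using this
  star_mul_self a := by
    have := q.star_mul_self (φ a)
    simpa [map_star] using this

instance : Zero (CStarSeminorm A) := ⟨⟨0, by simp, by simp⟩⟩

end CStarSeminorm

/-! ### Universal C⋆-algebras -/

section Universal

variable (A : Type*) [NonUnitalRing A] [StarRing A] [Module ℂ A]

/-- The C⋆-seminorms on `A` in which all elements of `rels` vanish. -/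
def admissible (rels : Set A) : Set (CStarSeminorm A) := {q | ∀ x ∈ rels, q x = 0}

/-- Every element of `A` is bounded in all C⋆-seminorms that respect the relations. -/
def IsBounded (rels : Set A) : Prop :=
  ∀ a : A, BddAbove (Set.range fun q : admissible A rels => q.1 a)

variable {A} {rels : Set A}

instance : Nonempty (admissible A rels) := ⟨⟨0, fun _ _ => rfl⟩⟩

/-- The largest C⋆-seminorm on `A` that respects the relations. -/
def maxSeminorm (h : IsBounded A rels) : CStarSeminorm A where
  toSeminorm := Seminorm.ofSMulLE (fun a => ⨆ q : admissible A rels, q.1 a)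
    (by simp)
    (fun a b => ciSup_le fun q => (map_add_le_add q.1.toSeminorm a b).trans
      (add_le_add (le_ciSup (h a) q) (le_ciSup (h b) q)))
    (fun c a => ciSup_le fun q => (map_smul_eq_mul q.1.toSeminorm c a).le.trans
      (mul_le_mul_of_nonneg_left (le_ciSup (h a) q) (norm_nonneg c)))
  mul_le a b := ciSup_le fun q => (q.1.mul_le a b).trans
    (mul_le_mul (le_ciSup (h a) q) (le_ciSup (h b) q) (q.1.nonneg b)
      ((q.1.nonneg a).trans (le_ciSup (h a) q)))
  star_mul_self a := by
    change (⨆ q : admissible A rels, q.1 (star a * a)) = (⨆ q : admissible A rels, q.1 a) ^ 2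
    have h0 : 0 ≤ ⨆ q : admissible A rels, q.1 a := Real.iSup_nonneg fun q => q.1.nonneg a
    apply le_antisymm
    · refine ciSup_le fun q => ?_
      rw [q.1.star_mul_self]
      exact pow_le_pow_left₀ (q.1.nonneg a) (le_ciSup (h a) q) 2
    · have h1 : 0 ≤ ⨆ q : admissible A rels, q.1 (star a * a) :=
        Real.iSup_nonneg fun q => q.1.nonneg _
      rw [← Real.le_sqrt h0 h1]
      refine ciSup_le fun q => ?_
      rw [Real.le_sqrt (q.1.nonneg a) h1, ← q.1.star_mul_self]
      exact le_ciSup (h (star a * a)) q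

/-- The universal C⋆-algebra generated by the ⋆-algebra `A` subject to the relations `x = 0` for
`x ∈ rels`: the completion of `A` in the largest C⋆-seminorm that respects the relations. -/
abbrev UniversalCStar (h : IsBounded A rels) : Type _ := (maxSeminorm h).Compl

end Universal

/-! ### Crossed products by discrete groups -/

section CrossedProduct

variable {G A : Type*} [Group G] [NonUnitalCStarAlgebra A]

/-- The ⋆-algebra `C_c(G, A)` of finitely supported functions from the discrete group `G` to `A`
with the convolution product twisted by `α`; `single g a` stands for the formal product
`a · V_g`. -/
def AlgCrossedProduct (_α : G →* (A ≃⋆ₐ[ℂ] A)) : Type _ := G →₀ A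

namespace AlgCrossedProduct

variable (α : G →* (A ≃⋆ₐ[ℂ] A))

instance : AddCommGroup (AlgCrossedProduct α) := inferInstanceAs (AddCommGroup (G →₀ A))
instance : Module ℂ (AlgCrossedProduct α) := inferInstanceAs (Module ℂ (G →₀ A))

/-- The element `a · V_g` of the algebraic crossed product, as an additive map in `a`. -/
def single (g : G) : A →+ AlgCrossedProduct α := Finsupp.singleAddHom g

variable {α}

@[elab_as_elim]
theorem ind {P : AlgCrossedProduct α → Prop} (x : AlgCrossedProduct α)
    (single : ∀ g a, P (single α g a)) (add : ∀ x y, P x → P y → P (x + y)) : P x :=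
  Finsupp.induction_linear (motive := P) x (by
    have h := single 1 0
    rw [map_zero] at h
    exact h) add single

theorem smul_single (c : ℂ) (g : G) (a : A) : c • single α g a = single α g (c • a) :=
  Finsupp.smul_single c g a

variable (α) in
/-- The product, determined by `(a · V_s) (b · V_t) = a α_s(b) · V_{st}`. -/
def mulHom : AlgCrossedProduct α →+ AlgCrossedProduct α →+ AlgCrossedProduct α :=
  Finsupp.liftAddHom fun s => AddMonoidHom.flip <| Finsupp.liftAddHom fun t =>
    AddMonoidHom.flip <| (AddMonoidHom.compr₂ (AddMonoidHom.mul.compl₂ ((α s : A →+ A)))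
      (single α (s * t)))

variable (α) in
/-- The involution, determined by `(a · V_s)⋆ = α_{s⁻¹}(a⋆) · V_{s⁻¹}`. -/
def starHom : AlgCrossedProduct α →+ AlgCrossedProduct α :=
  Finsupp.liftAddHom fun s =>
    (single α s⁻¹).comp (((α s⁻¹ : A →+ A)).comp (starAddEquiv : A ≃+ A).toAddMonoidHom)

instance : Mul (AlgCrossedProduct α) := ⟨fun x y => mulHom α x y⟩
instance : Star (AlgCrossedProduct α) := ⟨fun x => starHom α x⟩

theorem single_mul_single (s t : G) (a b : A) :
    single α s a * single α t b = single α (s * t) (a * α s b) := by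
  have h : mulHom α (single α s a) = AddMonoidHom.flip (Finsupp.liftAddHom fun t =>
      AddMonoidHom.flip <| (AddMonoidHom.compr₂ (AddMonoidHom.mul.compl₂ ((α s : A →+ A)))
        (single α (s * t)))) a := Finsupp.liftAddHom_apply_single _ s a
  have h2 := DFunLike.congr_fun h (single α t b)
  exact h2.trans (DFunLike.congr_fun (Finsupp.liftAddHom_apply_single (fun t =>
      AddMonoidHom.flip <| (AddMonoidHom.compr₂ (AddMonoidHom.mul.compl₂ ((α s : A →+ A)))
        (single α (s * t)))) t b) a)

theorem star_single (s : G) (a : A) : star (single α s a) = single α s⁻¹ (α s⁻¹ (star a)) := by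
  exact Finsupp.liftAddHom_apply_single (fun s =>
    (single α s⁻¹).comp (((α s⁻¹ : A →+ A)).comp (starAddEquiv : A ≃+ A).toAddMonoidHom)) s a

theorem add_mul' (x y z : AlgCrossedProduct α) : (x + y) * z = x * z + y * z :=
  congrArg (· z) (map_add (mulHom α) x y)

theorem mul_add' (x y z : AlgCrossedProduct α) : x * (y + z) = x * y + x * z :=
  map_add (mulHom α x) y z

theorem star_add' (x y : AlgCrossedProduct α) : star (x + y) = star x + star y :=
  map_add (starHom α) x y

instance : NonUnitalRing (AlgCrossedProduct α) where
  __ := (inferInstance : AddCommGroup (AlgCrossedProduct α))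
  left_distrib := mul_add'
  right_distrib := add_mul'
  zero_mul x := congrArg (· x) (map_zero (mulHom α))
  mul_zero x := map_zero (mulHom α x)
  mul_assoc x y z := by
    refine ind x (fun s a => ?_) fun x₁ x₂ h₁ h₂ => by simp only [add_mul', h₁, h₂]
    refine ind y (fun t b => ?_) fun x₁ x₂ h₁ h₂ => by simp only [add_mul', mul_add', h₁, h₂]
    refine ind z (fun r c => ?_) fun x₁ x₂ h₁ h₂ => by simp only [mul_add', h₁, h₂]
    simp [single_mul_single, mul_assoc]

instance : StarRing (AlgCrossedProduct α) where
  star_involutive x := by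
    refine ind x (fun s a => ?_) fun x₁ x₂ h₁ h₂ => by simp only [star_add', h₁, h₂]
    rw [star_single, star_single, ← map_star, star_star, ← StarAlgEquiv.mul_apply, ← map_mul]
    simp
  star_mul x y := by
    refine ind x (fun s a => ?_) fun x₁ x₂ h₁ h₂ => by
      simp only [add_mul', mul_add', star_add', h₁, h₂]
    refine ind y (fun t b => ?_) fun x₁ x₂ h₁ h₂ => by
      simp only [add_mul', mul_add', star_add', h₁, h₂]
    simp only [single_mul_single, star_single, mul_inv_rev, star_mul, map_mul, ← map_star,
      StarAlgEquiv.mul_apply]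
    congr 3
    rw [← StarAlgEquiv.mul_apply (α s⁻¹), ← map_mul]
    simp
  star_add := star_add'

instance : IsScalarTower ℂ (AlgCrossedProduct α) (AlgCrossedProduct α) where
  smul_assoc c x y := by
    change c • x * y = c • (x * y)
    refine ind x (fun s a => ?_) fun x₁ x₂ h₁ h₂ => by simp only [add_mul, smul_add, h₁, h₂]
    refine ind y (fun t b => ?_) fun x₁ x₂ h₁ h₂ => by simp only [mul_add, smul_add, h₁, h₂]
    simp only [smul_single, single_mul_single, smul_mul_assoc]

instance : SMulCommClass ℂ (AlgCrossedProduct α) (AlgCrossedProduct α) where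
  smul_comm c x y := by
    change c • (x * y) = x * c • y
    refine ind x (fun s a => ?_) fun x₁ x₂ h₁ h₂ => by simp only [add_mul, smul_add, h₁, h₂]
    refine ind y (fun t b => ?_) fun x₁ x₂ h₁ h₂ => by simp only [mul_add, smul_add, h₁, h₂]
    simp only [smul_single, single_mul_single, map_smul, mul_smul_comm]

instance : StarModule ℂ (AlgCrossedProduct α) where
  star_smul c x := by
    refine ind x (fun s a => ?_) fun x₁ x₂ h₁ h₂ => by simp only [star_add, smul_add, h₁, h₂]
    simp only [smul_single, star_single, star_smul, map_smul]

variable (α) in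
/-- The inclusion of the coefficient algebra `A`. -/
def inclusion : A →⋆ₙₐ[ℂ] AlgCrossedProduct α where
  toFun := single α 1
  map_smul' c a := (smul_single c 1 a).symm
  map_zero' := map_zero _
  map_add' := map_add _
  map_mul' a b := by simp [single_mul_single]
  map_star' a := by simp [star_single]

variable (α) in
theorem isBounded : IsBounded (AlgCrossedProduct α) ∅ := by
  intro x
  refine ind x (fun s a => ⟨‖a‖, ?_⟩) ?_
  · rintro _ ⟨q, rfl⟩
    have h := q.1.star_mul_self (star (single α s a))
    rw [star_star, star_single, single_mul_single, ← star_single, q.1.star_eq, mul_inv_cancel,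
      ← StarAlgEquiv.mul_apply, ← map_mul, mul_inv_cancel, map_one, StarAlgEquiv.one_apply] at h
    have h1 := (q.1.comap (inclusion α)).le_norm (a * star a)
    have h2 : q.1 (single α s a) ^ 2 ≤ ‖a‖ ^ 2 := by
      rw [← h, sq ‖a‖, ← CStarRing.norm_self_mul_star]; exact h1
    exact (sq_le_sq₀ (q.1.nonneg _) (norm_nonneg _)).1 h2
  · rintro x y ⟨C, hC⟩ ⟨D, hD⟩
    refine ⟨C + D, ?_⟩
    rintro _ ⟨q, rfl⟩
    exact (map_add_le_add q.1.toSeminorm x y).trans (add_le_add (hC ⟨q, rfl⟩) (hD ⟨q, rfl⟩))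

end AlgCrossedProduct

/-- The (full) crossed product `A ⋊ G` of a C⋆-algebra by an action `α` of a discrete group:
the completion of `C_c(G, A)` in its largest C⋆-seminorm. -/
def CrossedProduct (α : G →* (A ≃⋆ₐ[ℂ] A)) : Type _ :=
  UniversalCStar (AlgCrossedProduct.isBounded α)

instance (α : G →* (A ≃⋆ₐ[ℂ] A)) : NonUnitalCStarAlgebra (CrossedProduct α) :=
  inferInstanceAs (NonUnitalCStarAlgebra (UniversalCStar (AlgCrossedProduct.isBounded α)))

/-- The canonical map `A → A ⋊ G`. -/
def CrossedProduct.inclusion (α : G →* (A ≃⋆ₐ[ℂ] A)) : A →⋆ₙₐ[ℂ] CrossedProduct α :=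
  (maxSeminorm (AlgCrossedProduct.isBounded α)).toCompl.comp (AlgCrossedProduct.inclusion α)

/-- The element `V_g a = α_g(a) V_g` of the crossed product, for `g ∈ G` and `a ∈ A`. -/
def CrossedProduct.V (α : G →* (A ≃⋆ₐ[ℂ] A)) (g : G) (a : A) : CrossedProduct α :=
  (maxSeminorm (AlgCrossedProduct.isBounded α)).toCompl (AlgCrossedProduct.single α g (α g a))

end CrossedProduct

/-! ### Inductive limits of C⋆-algebras -/

section InductiveLimit

variable {ι : Type*} [Preorder ι] [IsDirectedOrder ι] [Nonempty ι]
  {F : ι → Type*} [∀ i, NonUnitalCStarAlgebra (F i)]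
  (f : ∀ i j, i ≤ j → F i →⋆ₙₐ[ℂ] F j) [DirectedSystem F (f · · ·)]

/-- The canonical map of `F i` to the algebraic inductive limit. -/
def toDirectLimit (i : ι) : F i →⋆ₙₐ[ℂ] DirectLimit F f where
  toFun x := ⟦⟨i, x⟩⟧
  map_smul' c x := (DirectLimit.smul_def i x c).symm
  map_zero' := (DirectLimit.zero_def i).symm
  map_add' x y := (DirectLimit.add_def i x y).symm
  map_mul' x y := (DirectLimit.mul_def i x y).symm
  map_star' x := (DirectLimit.star_def i x).symm

theorem directLimit_isBounded : IsBounded (DirectLimit F f) ∅ := by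
  intro x
  induction x using DirectLimit.induction with
  | ih i x =>
    refine ⟨‖x‖, ?_⟩
    rintro _ ⟨q, rfl⟩
    exact (q.1.comap (toDirectLimit f i)).le_norm x

/-- The inductive limit of a directed system of C⋆-algebras: the completion of the algebraic
inductive limit in its largest C⋆-seminorm. -/
def InductiveLimit : Type _ := UniversalCStar (directLimit_isBounded f)

instance : NonUnitalCStarAlgebra (InductiveLimit f) :=
  inferInstanceAs (NonUnitalCStarAlgebra (UniversalCStar (directLimit_isBounded f)))

/-- The canonical map of `F i` to the inductive limit. -/
def InductiveLimit.of (i : ι) : F i →⋆ₙₐ[ℂ] InductiveLimit f :=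
  (maxSeminorm (directLimit_isBounded f)).toCompl.comp (toDirectLimit f i)

end InductiveLimit

/-! ### The free ⋆-algebra -/

section Free

/-- The free unital complex ⋆-algebra on a set `X`: the free algebra on the letters `x = inl x` and
`x⋆ = inr x`. -/
def FreeStarAlgebra (X : Type*) : Type _ := FreeAlgebra ℂ (X ⊕ X)

namespace FreeStarAlgebra

variable {X : Type*}

instance : Ring (FreeStarAlgebra X) := inferInstanceAs (Ring (FreeAlgebra ℂ (X ⊕ X)))
instance : Algebra ℂ (FreeStarAlgebra X) := inferInstanceAs (Algebra ℂ (FreeAlgebra ℂ (X ⊕ X)))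

/-- The letters of the free ⋆-algebra. -/
def letter (x : X ⊕ X) : FreeStarAlgebra X := FreeAlgebra.ι ℂ x

/-- The generators of the free ⋆-algebra. -/
def gen (x : X) : FreeStarAlgebra X := letter (Sum.inl x)

@[elab_as_elim]
theorem ind {P : FreeStarAlgebra X → Prop} (a : FreeStarAlgebra X)
    (scalar : ∀ c : ℂ, P (algebraMap ℂ _ c)) (letter : ∀ x, P (letter x))
    (mul : ∀ a b, P a → P b → P (a * b)) (add : ∀ a b, P a → P b → P (a + b)) : P a :=
  FreeAlgebra.induction ℂ (X ⊕ X) (motive := P) scalar letter mul add a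

/-- A copy of the opposite of the free ⋆-algebra on which scalars act by their conjugates. -/
def ConjOp (X : Type*) : Type _ := (FreeStarAlgebra X)ᵐᵒᵖ

instance : Ring (ConjOp X) := inferInstanceAs (Ring (FreeStarAlgebra X)ᵐᵒᵖ)
instance : Algebra ℂ (ConjOp X) :=
  ((algebraMap ℂ (FreeStarAlgebra X)ᵐᵒᵖ).comp (starRingEnd ℂ)).toAlgebra'
    fun c x => Algebra.commutes (A := (FreeStarAlgebra X)ᵐᵒᵖ) (starRingEnd ℂ c) x

/-- The involution, as a homomorphism to the conjugate opposite algebra: it exchanges the letters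
`x` and `x⋆`. -/
def starHom : FreeStarAlgebra X →ₐ[ℂ] ConjOp X :=
  FreeAlgebra.lift ℂ fun x : X ⊕ X => (MulOpposite.op (letter x.swap) : (FreeStarAlgebra X)ᵐᵒᵖ)

instance : Star (FreeStarAlgebra X) :=
  ⟨fun a => MulOpposite.unop (show (FreeStarAlgebra X)ᵐᵒᵖ from starHom a)⟩

theorem star_letter (x : X ⊕ X) : star (letter x) = letter x.swap :=
  congrArg MulOpposite.unop (FreeAlgebra.lift_ι_apply (A := ConjOp X) _ x)

theorem star_algebraMap (c : ℂ) :
    star (algebraMap ℂ (FreeStarAlgebra X) c) = algebraMap ℂ _ (star c) :=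
  congrArg MulOpposite.unop (starHom.commutes c)

theorem star_add' (a b : FreeStarAlgebra X) : star (a + b) = star a + star b :=
  congrArg MulOpposite.unop (map_add starHom a b)

theorem star_mul' (a b : FreeStarAlgebra X) : star (a * b) = star b * star a :=
  congrArg MulOpposite.unop (map_mul starHom a b)

instance : StarRing (FreeStarAlgebra X) where
  star_involutive a := ind a (fun c => by simp only [star_algebraMap, star_star])
    (fun x => by simp only [star_letter, Sum.swap_swap])
    (fun a b ha hb => by simp only [star_mul', ha, hb])
    (fun a b ha hb => by simp only [star_add', ha, hb])
  star_mul := star_mul'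
  star_add := star_add'

instance : StarModule ℂ (FreeStarAlgebra X) where
  star_smul c a := by
    rw [Algebra.smul_def, star_mul, star_algebraMap, Algebra.smul_def, Algebra.commutes]

/-- It suffices to bound the generators. -/
theorem isBounded_of_gen {rels : Set (FreeStarAlgebra X)}
    (h : ∀ x, BddAbove (Set.range fun q : admissible (FreeStarAlgebra X) rels => q.1 (gen x))) :
    IsBounded (FreeStarAlgebra X) rels := by
  intro a
  induction a using ind with
  | scalar c =>
    refine ⟨‖c‖, ?_⟩
    rintro _ ⟨q, rfl⟩
    have h1 : q.1 (1 : FreeStarAlgebra X) ≤ 1 := by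
      have := q.1.star_mul_self 1
      rw [star_one, mul_one] at this
      nlinarith [q.1.nonneg (1 : FreeStarAlgebra X)]
    have h2 := map_smul_eq_mul q.1.toSeminorm c (1 : FreeStarAlgebra X)
    rw [← Algebra.algebraMap_eq_smul_one] at h2
    change q.1.toSeminorm _ ≤ _
    rw [h2]
    exact mul_le_of_le_one_right (norm_nonneg c) h1
  | letter x =>
    rcases x with x | x
    · exact h x
    · obtain ⟨C, hC⟩ := h x
      refine ⟨C, ?_⟩
      rintro _ ⟨q, rfl⟩
      have h1 : (letter (Sum.inr x) : FreeStarAlgebra X) = star (gen x) :=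
        (star_letter (Sum.inl x)).symm
      change q.1 _ ≤ C
      rw [h1, q.1.star_eq]
      exact hC ⟨q, rfl⟩
  | mul a b ha hb =>
    obtain ⟨C, hC⟩ := ha
    obtain ⟨D, hD⟩ := hb
    refine ⟨C * D, ?_⟩
    rintro _ ⟨q, rfl⟩
    have h1 := hC ⟨q, rfl⟩
    exact (q.1.mul_le a b).trans (mul_le_mul h1 (hD ⟨q, rfl⟩) (q.1.nonneg b)
      ((q.1.nonneg a).trans h1))
  | add a b ha hb =>
    obtain ⟨C, hC⟩ := ha
    obtain ⟨D, hD⟩ := hb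
    refine ⟨C + D, ?_⟩
    rintro _ ⟨q, rfl⟩
    exact (map_add_le_add q.1.toSeminorm a b).trans (add_le_add (hC ⟨q, rfl⟩) (hD ⟨q, rfl⟩))

end FreeStarAlgebra

end Free

/-! ### The C⋆-algebra of an integral domain and its stabilization -/

section RingAlgebra

variable (R : Type*) [CommRing R]

/-- The symbols `s_m` (`0 ≠ m ∈ R`) and `u^n` (`n ∈ R`). -/
inductive Gen : Type _
  | s (m : R⁰) : Gen
  | u (n : R) : Gen

variable {R}

/-- The symbol `s_m` in the free ⋆-algebra. -/
def fs (m : R⁰) : FreeStarAlgebra (Gen R) := .gen (.s m)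

/-- The symbol `u^n` in the free ⋆-algebra. -/
def fu (n : R) : FreeStarAlgebra (Gen R) := .gen (.u n)

variable (R)

/-- The defining relations of `𝔄[R]`, written as elements which have to vanish. In the last one
`q.out` is a representative of the coset `q`. -/
inductive Rel : FreeStarAlgebra (Gen R) → Prop
  | isometry (m : R⁰) : Rel (star (fs m) * fs m - 1)
  | unitary_left (n : R) : Rel (star (fu n) * fu n - 1)
  | unitary_right (n : R) : Rel (fu n * star (fu n) - 1)
  | s_mul (k m : R⁰) : Rel (fs k * fs m - fs (k * m))
  | u_mul (l n : R) : Rel (fu l * fu n - fu (l + n))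
  | s_mul_u (m : R⁰) (n : R) : Rel (fs m * fu n - fu (m * n) * fs m)
  | sum_eq_one (m : R⁰) :
      Rel ((∑ᶠ q : R ⧸ Ideal.span {(m : R)},
        fu q.out * (fs m * star (fs m)) * fu (-q.out)) - 1)

theorem rel_isBounded : IsBounded (FreeStarAlgebra (Gen R)) {x | Rel R x} := by
  have key : ∀ (q : admissible (FreeStarAlgebra (Gen R)) {x | Rel R x})
      (x : FreeStarAlgebra (Gen R)), q.1 (star x * x - 1) = 0 → q.1 x ≤ 1 := by
    intro q x hx
    have h1 : q.1 (1 : FreeStarAlgebra (Gen R)) ≤ 1 := by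
      have := q.1.star_mul_self 1
      rw [star_one, mul_one] at this
      nlinarith [q.1.nonneg (1 : FreeStarAlgebra (Gen R))]
    have h2 := map_add_le_add q.1.toSeminorm (star x * x - 1) 1
    rw [sub_add_cancel, hx, q.1.star_mul_self] at h2
    nlinarith [q.1.nonneg x]
  refine FreeStarAlgebra.isBounded_of_gen fun x => ⟨1, ?_⟩
  rintro _ ⟨q, rfl⟩
  cases x with
  | s m => exact key q (fs m) (q.2 _ (Rel.isometry m))
  | u n => exact key q (fu n) (q.2 _ (Rel.unitary_left n))

/-- The universal C⋆-algebra `𝔄[R]` generated by isometries `s_m` and unitaries `u^n` subject to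
the relations above. -/
def RingAlg : Type _ := UniversalCStar (rel_isBounded R)

instance : NonUnitalCStarAlgebra (RingAlg R) :=
  inferInstanceAs (NonUnitalCStarAlgebra (UniversalCStar (rel_isBounded R)))

variable {R}

/-- The canonical map of the free ⋆-algebra to `𝔄[R]`. -/
def RingAlg.of : FreeStarAlgebra (Gen R) →⋆ₙₐ[ℂ] RingAlg R :=
  (maxSeminorm (rel_isBounded R)).toCompl

/-- The isometry `s_m ∈ 𝔄[R]`. -/
def RingAlg.s (m : R⁰) : RingAlg R := RingAlg.of (fs m)

/-- The unitary `u^n ∈ 𝔄[R]`. -/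
def RingAlg.u (n : R) : RingAlg R := RingAlg.of (fu n)

/-- The unit of `𝔄[R]`. -/
instance : One (RingAlg R) := ⟨RingAlg.of 1⟩

namespace RingAlg

theorem of_rel {x : FreeStarAlgebra (Gen R)} (h : Rel R x) : (of x : RingAlg R) = 0 := by
  rw [← norm_eq_zero]
  refine ((maxSeminorm (rel_isBounded R)).norm_coe x).trans ?_
  change (⨆ q : admissible (FreeStarAlgebra (Gen R)) {x | Rel R x}, q.1 x) = 0
  rw [show (fun q : admissible (FreeStarAlgebra (Gen R)) {x | Rel R x} => q.1 x) = fun _ => 0 from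
    funext fun q => q.2 x h]
  simp

theorem of_eq {x y : FreeStarAlgebra (Gen R)} (h : Rel R (x - y)) :
    (of x : RingAlg R) = of y := by
  have := of_rel h
  rwa [map_sub, sub_eq_zero] at this

theorem one_mul' (x : RingAlg R) : 1 * x = x :=
  (maxSeminorm (rel_isBounded R)).coe_unit_mul (e := 1) (fun a => one_mul a) x

theorem star_s_mul_s (m : R⁰) : star (s m) * s m = (1 : RingAlg R) := by
  rw [s, ← map_star, ← map_mul]
  exact of_eq (Rel.isometry m)

theorem s_mul_s (k m : R⁰) : s k * s m = (s (k * m) : RingAlg R) := by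
  rw [s, s, ← map_mul]
  exact of_eq (Rel.s_mul k m)

/-- The endomorphism `x ↦ s_l x s_l⋆` of `𝔄[R]`. -/
def conj (l : R⁰) : RingAlg R →⋆ₙₐ[ℂ] RingAlg R where
  toFun x := s l * x * star (s l)
  map_smul' c x := by simp [mul_smul_comm, smul_mul_assoc]
  map_zero' := by simp
  map_add' x y := by simp [mul_add, add_mul]
  map_mul' x y := by
    have h : star (s l) * (s l * (y * star (s l))) = y * star (s l) := by
      rw [← mul_assoc, star_s_mul_s, one_mul']
    simp only [mul_assoc, h]
  map_star' x := by simp [mul_assoc]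

theorem conj_conj (k l : R⁰) (x : RingAlg R) : conj k (conj l x) = conj (k * l) x := by
  change s k * (s l * x * star (s l)) * star (s k) = s (k * l) * x * star (s (k * l))
  rw [← s_mul_s, star_mul]
  simp only [mul_assoc]

theorem s_one : (s 1 : RingAlg R) = 1 := by
  have h := s_mul_s (1 : R⁰) 1
  rw [one_mul] at h
  have h2 := congrArg (star (s (1 : R⁰)) * ·) h
  simp only [← mul_assoc, star_s_mul_s] at h2
  rwa [one_mul'] at h2

end RingAlg

variable (R) in
/-- The nonzero elements of `R` as an index set, (pre)ordered by divisibility. -/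
structure DivIndex where
  val : R⁰

instance : Nonempty (DivIndex R) := ⟨⟨1⟩⟩

instance : Preorder (DivIndex R) where
  le m n := ∃ l : R⁰, n.val = l * m.val
  le_refl m := ⟨1, (one_mul m.val).symm⟩
  le_trans m n k := by
    rintro ⟨l, hl⟩ ⟨l', hl'⟩
    exact ⟨l' * l, by rw [hl', hl, mul_assoc]⟩

instance : IsDirectedOrder (DivIndex R) where
  directed m n := ⟨⟨m.val * n.val⟩, ⟨n.val, mul_comm _ _⟩, ⟨m.val, rfl⟩⟩

/-- The connecting map `φ_{m,lm} : 𝔄[R] → 𝔄[R]`, `x ↦ s_l x s_l⋆`, where `l` is the quotient of the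
two indices. -/
def connect (m n : DivIndex R) (h : m ≤ n) : RingAlg R →⋆ₙₐ[ℂ] RingAlg R :=
  RingAlg.conj h.choose

theorem connect_eq (m n : DivIndex R) (h : m ≤ n) (l : R⁰) (hl : n.val = l * m.val) :
    connect m n h = RingAlg.conj l := by
  have h1 := h.choose_spec
  rw [connect]
  congr 1
  have h2 : ((h.choose : R⁰) : R) * m.val = l * m.val := by
    exact_mod_cast h1.symm.trans hl
  exact Subtype.ext ((mul_cancel_right_mem_nonZeroDivisors m.val.2).1 h2)

instance : DirectedSystem (fun _ : DivIndex R => RingAlg R) (connect · · ·) where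
  map_self m x := by
    rw [connect_eq m m le_rfl 1 (one_mul m.val).symm]
    change RingAlg.s 1 * x * star (RingAlg.s 1) = x
    rw [RingAlg.s_one]
    have h := congrArg star (RingAlg.one_mul' (star x))
    rw [star_mul, star_star] at h
    rw [RingAlg.one_mul', h]
  map_map k n m hmn hnk x := by
    obtain ⟨l, hl⟩ := id hmn
    obtain ⟨l', hl'⟩ := id hnk
    rw [connect_eq _ _ hmn l hl, connect_eq _ _ hnk l' hl',
      connect_eq _ _ (hmn.trans hnk) (l' * l) (by rw [hl', hl, mul_assoc]),
      RingAlg.conj_conj]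

variable (R) in
/-- The stabilization `𝔄(R)`: the inductive limit of copies `𝔄(R)_m` of `𝔄[R]`, for `m` in the
nonzero elements of `R` ordered by divisibility, along the maps `φ_{m,lm} : x ↦ s_l x s_l⋆`. -/
def StableAlg : Type _ :=
  InductiveLimit (F := fun _ : DivIndex R => RingAlg R) connect

instance : NonUnitalCStarAlgebra (StableAlg R) :=
  inferInstanceAs (NonUnitalCStarAlgebra
    (InductiveLimit (F := fun _ : DivIndex R => RingAlg R) connect))

/-- The canonical map `𝔄[R] = 𝔄(R)_m → 𝔄(R)`. -/
def StableAlg.of (m : R⁰) : RingAlg R →⋆ₙₐ[ℂ] StableAlg R :=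
  InductiveLimit.of (F := fun _ : DivIndex R => RingAlg R) connect ⟨m⟩

end RingAlgebra

/-! ### The profinite completion and the finite adele space -/

section Adele

variable (R : Type*) [CommRing R]

theorem span_mul_le (l m : R⁰) :
    Ideal.span {((l * m : R⁰) : R)} ≤ Ideal.span {(m : R)} := by
  rw [Ideal.span_singleton_le_span_singleton]
  exact ⟨l, by rw [Submonoid.coe_mul, mul_comm]⟩

/-- The compatible families in `∏_{m ≠ 0} R/(m)`. -/
def hatSubalgebra : Subalgebra R (∀ m : R⁰, R ⧸ Ideal.span {(m : R)}) where
  carrier := {r | ∀ l m : R⁰, Ideal.Quotient.factor (span_mul_le R l m) (r (l * m)) = r m}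
  mul_mem' {a b} ha hb l m := by rw [Pi.mul_apply, Pi.mul_apply, map_mul, ha, hb]
  add_mem' {a b} ha hb l m := by rw [Pi.add_apply, Pi.add_apply, map_add, ha, hb]
  algebraMap_mem' _ _ _ := rfl

/-- The profinite completion `R̂ = lim R/(m)`. -/
def Hat : Type _ := hatSubalgebra R

instance : CommRing (Hat R) := inferInstanceAs (CommRing (hatSubalgebra R))
instance : Algebra R (Hat R) := inferInstanceAs (Algebra R (hatSubalgebra R))

variable {R}

/-- The component of an element of `R̂` in `R/(m)`. -/
def Hat.comp (x : Hat R) (m : R⁰) : R ⧸ Ideal.span {(m : R)} :=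
  (show hatSubalgebra R from x).1 m

/-- `R̂` carries the topology induced by the product of the discrete rings `R/(m)`. -/
instance : TopologicalSpace (Hat R) :=
  TopologicalSpace.induced Hat.comp (@Pi.topologicalSpace _ _ fun _ => ⊥)

variable (R) in
/-- The finite adele space `𝓡 = lim (R̂ ; multiplication by l : 𝓡_m → 𝓡_{lm})`, that is, the
quotient of `∐_{m ≠ 0} R̂` in which `x ∈ 𝓡_l` and `y ∈ 𝓡_m` are identified when `umx = uly` for
some `u`. It is a module over the quotient field of `R`. -/
def Adele : Type _ := LocalizedModule R⁰ (Hat R)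

instance : CommRing (Adele R) := inferInstanceAs (CommRing (LocalizedModule R⁰ (Hat R)))
instance : Module (FractionRing R) (Adele R) :=
  inferInstanceAs (Module (Localization R⁰) (LocalizedModule R⁰ (Hat R)))

/-- The map `ι_m : R̂ = 𝓡_m → 𝓡`. -/
def Adele.ι (m : R⁰) (x : Hat R) : Adele R := LocalizedModule.mk x m

/-- The inductive limit topology: a set is open iff its preimages under all `ι_m` are. -/
instance : TopologicalSpace (Adele R) :=
  ⨆ m : R⁰, TopologicalSpace.coinduced (Adele.ι m) inferInstance

namespace Hat

theorem ext {x y : Hat R} (h : ∀ m, x.comp m = y.comp m) : x = y :=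
  Subtype.ext (funext h)

theorem comp_compat (x : Hat R) (l m : R⁰) :
    Ideal.Quotient.factor (span_mul_le R l m) (x.comp (l * m)) = x.comp m :=
  (show hatSubalgebra R from x).2 l m

theorem comp_smul (r : R) (x : Hat R) (m : R⁰) :
    (r • x).comp m = Ideal.Quotient.mk _ r * x.comp m :=
  Algebra.smul_def r (x.comp m)

theorem comp_add (x y : Hat R) (m : R⁰) : (x + y).comp m = x.comp m + y.comp m := rfl

theorem continuous_rng {X : Type*} [TopologicalSpace X] {f : X → Hat R}
    (h : ∀ m, @Continuous _ _ _ ⊥ fun x => (f x).comp m) : Continuous f := by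
  let _ : ∀ m : R⁰, TopologicalSpace (R ⧸ Ideal.span {(m : R)}) := fun _ => ⊥
  exact continuous_induced_rng.2 (continuous_pi h)

theorem continuous_comp (m : R⁰) : @Continuous _ _ _ ⊥ fun x : Hat R => x.comp m := by
  let _ : ∀ m : R⁰, TopologicalSpace (R ⧸ Ideal.span {(m : R)}) := fun _ => ⊥
  exact (continuous_apply m).comp continuous_induced_dom

theorem continuous_affine (r : R) (y : Hat R) : Continuous fun x : Hat R => r • x + y := by
  refine continuous_rng fun m => ?_
  let _ : TopologicalSpace (R ⧸ Ideal.span {(m : R)}) := ⊥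
  have : DiscreteTopology (R ⧸ Ideal.span {(m : R)}) := ⟨rfl⟩
  have h : (fun x : Hat R => (r • x + y).comp m) =
      (fun z => Ideal.Quotient.mk _ r * z + y.comp m) ∘ fun x : Hat R => x.comp m :=
    funext fun x => by simp only [comp_add, comp_smul, Function.comp]
  rw [h]
  exact continuous_of_discreteTopology.comp (continuous_comp m)

theorem isClopen_comp_eq_zero (m : R⁰) : IsClopen {x : Hat R | x.comp m = 0} := by
  let _ : TopologicalSpace (R ⧸ Ideal.span {(m : R)}) := ⊥
  have : DiscreteTopology (R ⧸ Ideal.span {(m : R)}) := ⟨rfl⟩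
  exact (isClopen_discrete {(0 : R ⧸ Ideal.span {(m : R)})}).preimage (continuous_comp m)

/-- Multiplication by a nonzero element of `R` is injective on `R̂`. -/
theorem smul_cancel (l : R⁰) {x y : Hat R} (h : l • x = l • y) : x = y := by
  refine ext fun m => ?_
  have h1 := congrArg (fun z : Hat R => z.comp (l * m)) h
  change ((l : R) • x).comp (l * m) = ((l : R) • y).comp (l * m) at h1
  rw [comp_smul, comp_smul] at h1
  rw [← comp_compat x l m, ← comp_compat y l m]
  obtain ⟨a, ha⟩ := Ideal.Quotient.mk_surjective (x.comp (l * m))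
  obtain ⟨b, hb⟩ := Ideal.Quotient.mk_surjective (y.comp (l * m))
  rw [← ha, ← hb] at h1 ⊢
  rw [← map_mul, ← map_mul, Ideal.Quotient.eq, Ideal.mem_span_singleton] at h1
  rw [Ideal.Quotient.factor_mk, Ideal.Quotient.factor_mk, Ideal.Quotient.eq,
    Ideal.mem_span_singleton]
  obtain ⟨c, hc⟩ := h1
  refine ⟨c, (mul_cancel_left_mem_nonZeroDivisors l.2).1 ?_⟩
  rw [mul_sub, hc, Submonoid.coe_mul, mul_assoc]

/-- The kernel of the projection `R̂ → R/(l)` is `l R̂`. -/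
theorem comp_eq_zero_iff (l : R⁰) (x : Hat R) : x.comp l = 0 ↔ ∃ y : Hat R, x = l • y := by
  constructor
  · intro h
    have key : ∀ m : R⁰, ∃ b : R, x.comp (m * l) = Ideal.Quotient.mk _ ((l : R) * b) := by
      intro m
      obtain ⟨a, ha⟩ := Ideal.Quotient.mk_surjective (x.comp (m * l))
      have h1 := comp_compat x m l
      rw [h, ← ha, Ideal.Quotient.factor_mk, Ideal.Quotient.eq_zero_iff_mem,
        Ideal.mem_span_singleton] at h1
      obtain ⟨b, hb⟩ := h1
      exact ⟨b, by rw [← ha, hb]⟩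
    choose b hb using key
    have hmem : (fun m : R⁰ => Ideal.Quotient.mk (Ideal.span {(m : R)}) (b m)) ∈
        hatSubalgebra R := by
      intro k m
      have h1 := comp_compat x k (m * l)
      have h2 : ∀ n : R⁰, n = k * (m * l) → ∀ c : R, x.comp n = Ideal.Quotient.mk _ c →
          x.comp (k * (m * l)) = Ideal.Quotient.mk _ c := by
        rintro n rfl c hc
        exact hc
      rw [h2 _ (mul_assoc k m l) _ (hb (k * m)), hb m, Ideal.Quotient.factor_mk,
        Ideal.Quotient.eq, Ideal.mem_span_singleton] at h1
      rw [Ideal.Quotient.factor_mk, Ideal.Quotient.eq, Ideal.mem_span_singleton]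
      obtain ⟨c, hc⟩ := h1
      refine ⟨c, (mul_cancel_left_mem_nonZeroDivisors l.2).1 ?_⟩
      rw [mul_sub, hc, Submonoid.coe_mul]
      ring
    refine ⟨⟨_, hmem⟩, ext fun m => ?_⟩
    change _ = Hat.comp ((l : R) • (show Hat R from ⟨_, hmem⟩)) m
    have h1 := comp_compat x l m
    have h2 : ∀ n : R⁰, n = l * m → ∀ c : R, x.comp n = Ideal.Quotient.mk _ c →
        x.comp (l * m) = Ideal.Quotient.mk _ c := by
      rintro n rfl c hc
      exact hc
    rw [h2 _ (mul_comm m l) _ (hb m), Ideal.Quotient.factor_mk] at h1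
    rw [comp_smul, ← h1, map_mul]
    rfl
  · rintro ⟨y, rfl⟩
    change ((l : R) • y).comp l = 0
    rw [comp_smul, Ideal.Quotient.eq_zero_iff_mem.2 (Ideal.mem_span_singleton_self (l : R)),
      zero_mul]

instance [∀ m : R⁰, Finite (R ⧸ Ideal.span {(m : R)})] : CompactSpace (Hat R) := by
  let _ : ∀ m : R⁰, TopologicalSpace (R ⧸ Ideal.span {(m : R)}) := fun _ => ⊥
  have : ∀ m : R⁰, DiscreteTopology (R ⧸ Ideal.span {(m : R)}) := fun _ => ⟨rfl⟩
  have hi : Topology.IsInducing (Hat.comp : Hat R → _) := ⟨rfl⟩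
  have hr : Set.range (Hat.comp : Hat R → _) = ⋂ (l : R⁰) (m : R⁰),
      {r | Ideal.Quotient.factor (span_mul_le R l m) (r (l * m)) = r m} := by
    ext r
    simp only [Set.mem_iInter, Set.mem_range]
    exact ⟨fun ⟨x, hx⟩ l m => hx ▸ comp_compat x l m, fun h => ⟨⟨r, h⟩, rfl⟩⟩
  have hc : IsClosed (Set.range (Hat.comp : Hat R → _)) := by
    rw [hr]
    refine isClosed_iInter fun l => isClosed_iInter fun m => isClosed_eq ?_ (continuous_apply m)
    exact continuous_of_discreteTopology.comp (continuous_apply (l * m))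
  exact (Topology.IsClosedEmbedding.mk ⟨hi, fun x y h => ext fun m => congrFun h m⟩
    hc).compactSpace

end Hat

namespace Adele

theorem continuous_ι (m : R⁰) : Continuous (ι m : Hat R → Adele R) :=
  continuous_iff_coinduced_le.2 (le_iSup (fun m : R⁰ =>
    TopologicalSpace.coinduced (Adele.ι m : Hat R → Adele R) inferInstance) m)

theorem continuous_dom {Y : Type*} [TopologicalSpace Y] {f : Adele R → Y}
    (h : ∀ m, Continuous fun x => f (ι m x)) : Continuous f :=
  continuous_iSup_dom.2 fun m => continuous_coinduced_dom.2 (h m)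

variable (R) in
/-- The subset `R̂ = ι_1(R̂)` of `𝓡`. -/
def hat : Set (Adele R) := Set.range (ι 1)

theorem ι_preimage_hat (m : R⁰) : ι m ⁻¹' hat R = {x : Hat R | x.comp m = 0} := by
  ext x
  rw [Set.mem_ofPred_eq, Hat.comp_eq_zero_iff]
  constructor
  · rintro ⟨y, hy⟩
    obtain ⟨u, hu⟩ := LocalizedModule.mk_eq.1 hy
    refine ⟨y, ?_⟩
    have h := Hat.smul_cancel u hu
    rw [one_smul] at h
    exact h.symm
  · rintro ⟨y, rfl⟩
    exact ⟨y, LocalizedModule.mk_eq.2 ⟨1, by simp⟩⟩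

theorem isClopen_hat : IsClopen (hat R) := by
  constructor
  · rw [← isOpen_compl_iff, isOpen_iSup_iff]
    intro m
    rw [isOpen_coinduced, Set.preimage_compl, ι_preimage_hat]
    exact (Hat.isClopen_comp_eq_zero m).compl.isOpen
  · rw [isOpen_iSup_iff]
    intro m
    rw [isOpen_coinduced, ι_preimage_hat]
    exact (Hat.isClopen_comp_eq_zero m).isOpen

variable (R) in
/-- The characteristic function `p_{R̂} ∈ C₀(𝓡)` of the compact open subset `R̂`. -/
def pHat [∀ m : R⁰, Finite (R ⧸ Ideal.span {(m : R)})] : C₀(Adele R, ℂ) where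
  toFun := (hat R).indicator 1
  continuous_toFun := (IsClopen.continuous_indicator isClopen_hat continuous_const)
  zero_at_infty' := by
    have hK : IsCompact (hat R) := isCompact_range (continuous_ι 1)
    refine tendsto_const_nhds.congr' ?_
    filter_upwards [hK.compl_mem_cocompact] with x hx
    exact (Set.indicator_of_notMem hx _).symm

end Adele

end Adele

/-! ### The `ax + b`-group and its affine action -/

section AffineGroup

/-- The `ax + b`-group `P_K` of a field: the matrices with rows `(a, b)` and `(0, 1)`, `a ≠ 0`. -/
@[ext]
structure AffineGroup (K : Type*) [Field K] where
  a : Kˣ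
  b : K

namespace AffineGroup

variable {K : Type*} [Field K]

instance : Mul (AffineGroup K) := ⟨fun g h => ⟨g.a * h.a, g.a * h.b + g.b⟩⟩
instance : One (AffineGroup K) := ⟨⟨1, 0⟩⟩
instance : Inv (AffineGroup K) := ⟨fun g => ⟨g.a⁻¹, -(↑(g.a⁻¹) * g.b)⟩⟩

theorem mul_def (g h : AffineGroup K) : g * h = ⟨g.a * h.a, g.a * h.b + g.b⟩ := rfl
theorem one_def : (1 : AffineGroup K) = ⟨1, 0⟩ := rfl
theorem inv_def (g : AffineGroup K) : g⁻¹ = ⟨g.a⁻¹, -(↑(g.a⁻¹) * g.b)⟩ := rfl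

instance : Group (AffineGroup K) :=
  Group.ofLeftAxioms
    (fun g h k => by
      simp only [mul_def, mk.injEq, mul_assoc, Units.val_mul, true_and]
      ring)
    (fun g => by simp [mul_def, one_def])
    (fun g => by simp [mul_def, one_def, inv_def])

end AffineGroup

variable {R : Type*} [CommRing R] [IsDomain R]

/-- The action of `P_{Q(R)}` on `𝓡` by affine transformations `x ↦ a x + b`. -/
instance : MulAction (AffineGroup (FractionRing R)) (Adele R) where
  smul g x := (g.a : FractionRing R) • x + g.b • (1 : Adele R)
  one_smul x := by
    change (1 : FractionRing R) • x + (0 : FractionRing R) • (1 : Adele R) = x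
    simp
  mul_smul g h x := by
    change ((g.a * h.a : (FractionRing R)ˣ) : FractionRing R) • x +
        ((g.a : FractionRing R) * h.b + g.b) • (1 : Adele R) =
      (g.a : FractionRing R) • ((h.a : FractionRing R) • x + h.b • (1 : Adele R)) +
        g.b • (1 : Adele R)
    rw [Units.val_mul, mul_smul, add_smul, mul_smul, smul_add, add_assoc]

theorem Adele.smul_def (g : AffineGroup (FractionRing R)) (x : Adele R) :
    g • x = (g.a : FractionRing R) • x + g.b • (1 : Adele R) := rfl

/-- The affine transformations of `𝓡` are homeomorphisms. -/
instance : ContinuousConstSMul (AffineGroup (FractionRing R)) (Adele R) where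
  continuous_const_smul g := by
    refine Adele.continuous_dom fun m => ?_
    have hmk : ∀ y : FractionRing R, ∃ (c : R) (d : R⁰), y = Localization.mk c d := fun y =>
      Localization.induction_on y fun p => ⟨p.1, p.2, rfl⟩
    obtain ⟨c, d, hc⟩ := hmk (g.a : FractionRing R)
    obtain ⟨e, d', he⟩ := hmk g.b
    have h : (fun x => g • Adele.ι m x) = fun x : Hat R =>
        Adele.ι (d * m * (d' * 1)) (((d' * 1 : R⁰) * c : R) • x + (d * m) • (e • (1 : Hat R))) := by
      funext x
      rw [Adele.smul_def, hc, he]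
      have h1 : (1 : Adele R) = Adele.ι 1 1 := OreLocalization.one_def
      have h2 : Localization.mk c d • Adele.ι m x = Adele.ι (d * m) (c • x) :=
        LocalizedModule.mk_smul_mk ..
      have h3 : Localization.mk e d' • Adele.ι 1 (1 : Hat R) = Adele.ι (d' * 1) (e • 1) :=
        LocalizedModule.mk_smul_mk ..
      rw [h1, h2, h3, mul_smul]
      exact LocalizedModule.mk_add_mk
    rw [h]
    exact (Adele.continuous_ι _).comp (Hat.continuous_affine _ _)

end AffineGroup

section Translation

/-- The action `(α_g f)(x) = f(g⁻¹ x)` on `C₀(X)` induced by an action on `X` by homeomorphisms. -/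
def translation (G X : Type*) [Group G] [TopologicalSpace X] [MulAction G X]
    [ContinuousConstSMul G X] : G →* (C₀(X, ℂ) ≃⋆ₐ[ℂ] C₀(X, ℂ)) where
  toFun g :=
    { toFun := fun f => f.comp (Homeomorph.smul g⁻¹ : X ≃ₜ X).toCocompactMap
      invFun := fun f => f.comp (Homeomorph.smul g : X ≃ₜ X).toCocompactMap
      left_inv := fun f => by ext x; simp
      right_inv := fun f => by ext x; simp
      map_mul' := fun _ _ => rfl
      map_add' := fun _ _ => rfl
      map_star' := fun _ => rfl
      map_smul' := fun _ _ => rfl }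
  map_one' := by ext f x; simp
  map_mul' g h := by
    ext f x
    change f ((g * h)⁻¹ • x) = f (h⁻¹ • g⁻¹ • x)
    rw [mul_inv_rev, mul_smul]

end Translation

/-! ### The adelic crossed product and its corner -/

section Main

/-- The corner `p A p` of a C⋆-algebra, for a self-adjoint element (such as a projection) `p`. -/
def corner {A : Type*} [NonUnitalCStarAlgebra A] (p : A) (hp : IsSelfAdjoint p) :
    NonUnitalStarSubalgebra ℂ A where
  carrier := Set.range fun a => p * a * p
  add_mem' := by
    rintro _ _ ⟨a, rfl⟩ ⟨b, rfl⟩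
    exact ⟨a + b, by simp [mul_add, add_mul]⟩
  zero_mem' := ⟨0, by simp⟩
  mul_mem' := by
    rintro _ _ ⟨a, rfl⟩ ⟨b, rfl⟩
    exact ⟨a * p * p * b, by simp [mul_assoc]⟩
  smul_mem' := by
    rintro c _ ⟨a, rfl⟩
    exact ⟨c • a, by simp [mul_smul_comm, smul_mul_assoc]⟩
  star_mem' := by
    rintro _ ⟨a, rfl⟩
    exact ⟨star a, by simp [hp.star_eq, mul_assoc]⟩

variable (R : Type*) [CommRing R] [IsDomain R]

/-- The crossed product `C₀(𝓡) ⋊ P_{Q(R)}`. -/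
abbrev AdelicCrossedProduct : Type _ :=
  CrossedProduct (translation (AffineGroup (FractionRing R)) (Adele R))

variable [∀ m : R⁰, Finite (R ⧸ Ideal.span {(m : R)})]

variable {R} in
/-- The element `V_g p_{R̂}` of `C₀(𝓡) ⋊ P_{Q(R)}`. -/
def Vp (g : AffineGroup (FractionRing R)) : AdelicCrossedProduct R :=
  CrossedProduct.V _ g (Adele.pHat R)

/-- The projection `p_{R̂}` in the crossed product. -/
def projHat : AdelicCrossedProduct R := CrossedProduct.inclusion _ (Adele.pHat R)

theorem isSelfAdjoint_projHat : IsSelfAdjoint (projHat R) := by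
  have h : star (Adele.pHat R) = Adele.pHat R := by
    ext x
    change star ((Adele.hat R).indicator 1 x) = (Adele.hat R).indicator (1 : Adele R → ℂ) x
    by_cases hx : x ∈ Adele.hat R <;> simp [hx]
  rw [IsSelfAdjoint, projHat, ← map_star, h]

/-- The corner `p_{R̂} (C₀(𝓡) ⋊ P_{Q(R)}) p_{R̂}`. -/
abbrev AdelicCorner : NonUnitalStarSubalgebra ℂ (AdelicCrossedProduct R) :=
  corner (projHat R) (isSelfAdjoint_projHat R)

variable {R}

/-- The matrix with rows `(1, n)` and `(0, 1)`. -/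
def translationBy (n : R) : AffineGroup (FractionRing R) := ⟨1, algebraMap R _ n⟩

/-- The matrix with rows `(m, 0)` and `(0, 1)`. -/
def dilationBy (m : R⁰) : AffineGroup (FractionRing R) :=
  ⟨(IsLocalization.map_units (FractionRing R) m).unit, 0⟩

end Main

end

end RingCStar

open RingCStar

/-!
The elements `V_g p_{R̂}`, for integral dilations and translations `g`, satisfy the relations of
`𝔄[R]`: the only relation that is not formal is the last one, which says that `R̂` is the disjoint
union of the cosets `n + m R̂`. The universal property of `𝔄[R]` and the maps `x ↦ V_k⋆ β(x) V_k`
then give a homomorphism `Φ : 𝔄(R) → C₀(𝓡) ⋊ P_{Q(R)}`.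

A left inverse of `Φ` takes values in the multiplier algebra of `𝔄(R)`. In it the elements `s_m` and
`u^{kn}` of the copies `𝔄(R)_k` converge strictly, as `k` grows, to unitaries which generate a
representation of `P_{Q(R)}`. The translates of `p_{R̂}` span a dense subspace of `C₀(𝓡)`; on the
finite levels `k⁻¹ (n + m R̂)` their linear relations are only those of orthogonal projections, so
sending them to the translates of `ω₁(1)` is contractive on this span and extends to a
representation of `C₀(𝓡)`, covariant by construction. Its integrated form maps `Φ(x)` to `x`.
Hence `Φ` is injective, and its range is closed; since it contains every `V_g α_h(p_{R̂})`, it is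
everything. Cutting down by `ω₁(1)`, which `Φ` maps to `p_{R̂}`, gives the statement on corners.
-/

namespace RingCStar

noncomputable section

open scoped CStarAlgebra

/-! ### Universal properties -/

theorem norm_le_one_of_isStarProjection_star_mul_self {A : Type*} [NonUnitalNormedRing A]
    [StarRing A] [CStarRing A] {x : A} (hx : IsStarProjection (star x * x)) : ‖x‖ ≤ 1 := by
  refine (sq_le_one_iff₀ (norm_nonneg x)).1 ?_
  rw [sq, ← CStarRing.norm_star_mul_self]
  exact hx.norm_le _

namespace CStarSeminorm

/-- The norm of a C⋆-algebra as a C⋆-seminorm. -/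
def ofNorm (B : Type*) [NonUnitalCStarAlgebra B] : CStarSeminorm B where
  toSeminorm := normSeminorm ℂ B
  mul_le := norm_mul_le
  star_mul_self _ := CStarRing.norm_star_mul_self.trans (sq _).symm

variable {A B : Type*} [NonUnitalRing A] [StarRing A] [Module ℂ A] [NonUnitalCStarAlgebra B]
  (q : CStarSeminorm A)

theorem hom_ext [StarModule ℂ A] [IsScalarTower ℂ A A] [SMulCommClass ℂ A A]
    {φ ψ : q.Compl →⋆ₙₐ[ℂ] B} (h : ∀ a, φ (q.coe a) = ψ (q.coe a)) : φ = ψ :=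
  DFunLike.ext _ _ fun x => q.ind x (isClosed_eq (map_continuous φ) (map_continuous ψ)) h

variable (φ : A →⋆ₙₐ[ℂ] B) (hφ : ∀ a, ‖φ a‖ ≤ q a)

include hφ in
theorem uniformContinuous_of_norm_le : UniformContinuous (fun a : q.Pre => φ a : q.Pre → B) :=
  AddMonoidHomClass.uniformContinuous_of_bound
    (⟨⟨fun a => φ a, map_zero φ⟩, map_add φ⟩ : q.Pre →+ B) 1 fun a => by
      rw [one_mul]
      exact hφ a

/-- The extension to the completion of a ⋆-homomorphism bounded by the C⋆-seminorm `q`. -/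
def lift : q.Compl →⋆ₙₐ[ℂ] B :=
  let F : q.Compl → B := UniformSpace.Completion.extension (α := q.Pre) (fun a => φ a)
  have hF : Continuous F := UniformSpace.Completion.continuous_extension
  have hc : ∀ a, F (q.coe a) = φ a :=
    UniformSpace.Completion.extension_coe (α := q.Pre) (q.uniformContinuous_of_norm_le φ hφ)
  { toFun := F
    map_smul' := fun c x => q.ind x
      (isClosed_eq (hF.comp (continuous_const_smul c)) (hF.const_smul c)) fun a => by
        change F (c • q.coe a) = c • F (q.coe a)
        rw [← coe_smul, hc, hc, map_smul]
    map_zero' := by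
      rw [← q.coe_zero, hc, map_zero]
    map_add' := fun x y => q.ind₂ x y (isClosed_eq (hF.comp continuous_add)
      ((hF.comp continuous_fst).add (hF.comp continuous_snd))) fun a b => by
        rw [← coe_add, hc, hc, hc, map_add]
    map_mul' := fun x y => q.ind₂ x y (isClosed_eq (hF.comp continuous_mul)
      ((hF.comp continuous_fst).mul (hF.comp continuous_snd))) fun a b => by
        rw [← coe_mul, hc, hc, hc, map_mul]
    map_star' := fun x => q.ind x
      (isClosed_eq (hF.comp q.continuous_star_compl) (continuous_star.comp hF)) fun a => by
        rw [← coe_star, hc, hc, map_star] }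

theorem lift_coe (a : A) : q.lift φ hφ (q.coe a) = φ a :=
  UniformSpace.Completion.extension_coe (α := q.Pre) (q.uniformContinuous_of_norm_le φ hφ) a

end CStarSeminorm

section UniversalCStar

variable {A B : Type*} [NonUnitalRing A] [StarRing A] [Module ℂ A] [NonUnitalCStarAlgebra B]
  {rels : Set A} (h : IsBounded A rels)

theorem CStarSeminorm.le_maxSeminorm (q : CStarSeminorm A) (hq : ∀ x ∈ rels, q x = 0) (a : A) :
    q a ≤ maxSeminorm h a :=
  le_ciSup (h a) ⟨q, hq⟩

variable (φ : A →⋆ₙₐ[ℂ] B) (hφ : ∀ x ∈ rels, φ x = 0)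

/-- The universal property of `UniversalCStar`: a ⋆-homomorphism to a C⋆-algebra that respects the
relations extends. -/
def UniversalCStar.lift : UniversalCStar h →⋆ₙₐ[ℂ] B :=
  (maxSeminorm h).lift φ fun a =>
    CStarSeminorm.le_maxSeminorm h ((CStarSeminorm.ofNorm B).comap φ)
      (fun x hx => norm_eq_zero.2 (hφ x hx)) a

theorem UniversalCStar.lift_coe (a : A) : lift h φ hφ ((maxSeminorm h).coe a) = φ a :=
  CStarSeminorm.lift_coe _ _ _ a

end UniversalCStar

section CrossedProduct

variable {G A M : Type*} [Group G] [NonUnitalCStarAlgebra A] [CStarAlgebra M]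
  {α : G →* (A ≃⋆ₐ[ℂ] A)}

section Lift

variable (π : A →⋆ₙₐ[ℂ] M) (U : G →* unitary M) (hU : ∀ g a, (U g : M) * π a = π (α g a) * U g)

variable (α) in
/-- The additive map `a · V_g ↦ π(a) U_g` on the algebraic crossed product. -/
def AlgCrossedProduct.liftAddHom : AlgCrossedProduct α →+ M :=
  Finsupp.liftAddHom fun g => (AddMonoidHom.mulRight (U g : M)).comp (π : A →+ M)

theorem AlgCrossedProduct.liftAddHom_single (g : G) (a : A) :
    liftAddHom α π U (single α g a) = π a * U g :=
  Finsupp.liftAddHom_apply_single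
    (fun g => (AddMonoidHom.mulRight (U g : M)).comp (π : A →+ M)) g a

/-- The integrated form of a covariant pair `(π, U)` on the algebraic crossed product. -/
def AlgCrossedProduct.lift : AlgCrossedProduct α →⋆ₙₐ[ℂ] M where
  toFun := liftAddHom α π U
  map_zero' := map_zero _
  map_add' := map_add _
  map_smul' c x := by
    refine ind x (fun g a => ?_) fun x₁ x₂ h₁ h₂ => by
      rw [smul_add, map_add, h₁, h₂, map_add, smul_add]
    rw [smul_single, liftAddHom_single, liftAddHom_single, map_smul, smul_mul_assoc,
      MonoidHom.id_apply]
  map_mul' x y := by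
    refine ind x (fun s a => ?_) fun x₁ x₂ h₁ h₂ => by
      rw [add_mul, map_add, h₁, h₂, map_add, add_mul]
    refine ind y (fun t b => ?_) fun x₁ x₂ h₁ h₂ => by
      rw [mul_add, map_add, h₁, h₂, map_add, mul_add]
    rw [single_mul_single, liftAddHom_single, liftAddHom_single, liftAddHom_single, map_mul,
      map_mul, Submonoid.coe_mul, mul_assoc, mul_assoc, ← mul_assoc (π (α s b)), ← hU, mul_assoc]
  map_star' x := by
    refine ind x (fun s a => ?_) fun x₁ x₂ h₁ h₂ => by
      rw [star_add, map_add, h₁, h₂, map_add, star_add]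
    rw [star_single, liftAddHom_single, liftAddHom_single, star_mul, ← map_star, ← hU, map_inv]
    rfl

/-- The integrated form of a covariant pair `(π, U)` in a unital C⋆-algebra. -/
def CrossedProduct.lift : CrossedProduct α →⋆ₙₐ[ℂ] M :=
  UniversalCStar.lift (AlgCrossedProduct.isBounded α) (AlgCrossedProduct.lift π U hU)
    fun _ h => h.elim

theorem CrossedProduct.lift_V (g : G) (a : A) : lift π U hU (V α g a) = U g * π a := by
  rw [hU]
  exact (UniversalCStar.lift_coe (AlgCrossedProduct.isBounded α) (AlgCrossedProduct.lift π U hU)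
    (fun _ h => h.elim) _).trans (AlgCrossedProduct.liftAddHom_single π U g (α g a))

end Lift

namespace CrossedProduct

theorem V_mul_V (g h : G) (a b : A) : V α g a * V α h b = V α (g * h) (α h⁻¹ a * b) := by
  refine (map_mul (maxSeminorm (AlgCrossedProduct.isBounded α)).toCompl _ _).symm.trans ?_
  rw [AlgCrossedProduct.single_mul_single, V, map_mul (α (g * h))]
  congr 3
  · rw [← StarAlgEquiv.mul_apply, ← map_mul, mul_inv_cancel_right]
  · rw [map_mul, StarAlgEquiv.mul_apply]

theorem star_V (g : G) (a : A) : star (V α g a) = V α g⁻¹ (α g (star a)) := by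
  refine (map_star (maxSeminorm (AlgCrossedProduct.isBounded α)).toCompl _).symm.trans ?_
  rw [AlgCrossedProduct.star_single, V, map_star (α g)]

theorem V_one (a : A) : V α 1 a = inclusion α a := by
  rw [V, map_one]
  rfl

theorem star_V_mul_V (g : G) (a b : A) : star (V α g a) * V α g b = inclusion α (star a * b) := by
  rw [star_V, V_mul_V, inv_mul_cancel, ← StarAlgEquiv.mul_apply, ← map_mul, inv_mul_cancel,
    map_one, StarAlgEquiv.one_apply, V_one]

theorem norm_V_le (g : G) (a : A) : ‖V α g a‖ ≤ ‖a‖ := by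
  refine (mul_self_le_mul_self_iff (norm_nonneg _) (norm_nonneg _)).2 ?_
  rw [← CStarRing.norm_star_mul_self, ← CStarRing.norm_star_mul_self, star_V_mul_V]
  exact NonUnitalStarAlgHom.norm_apply_le (inclusion α) _

variable (α) in
/-- The map `a ↦ V_g a` as a continuous linear map. -/
def VL (g : G) : A →L[ℂ] CrossedProduct α :=
  LinearMap.mkContinuous
    { toFun := V α g
      map_add' := fun a b => by
        rw [V, map_add, map_add, map_add]
        rfl
      map_smul' := fun c a => by
        rw [V, map_smul, ← AlgCrossedProduct.smul_single, map_smul]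
        rfl } 1 fun a => (norm_V_le g a).trans_eq (one_mul _).symm

theorem eq_top_of_V_mem {W : Submodule ℂ (CrossedProduct α)}
    (hW : IsClosed (W : Set (CrossedProduct α))) (h : ∀ g a, V α g a ∈ W) : W = ⊤ := by
  refine Submodule.eq_top_iff'.2 fun x =>
    (maxSeminorm (AlgCrossedProduct.isBounded α)).ind x hW fun y => ?_
  refine AlgCrossedProduct.ind y (fun g a => ?_) fun y z hy hz => ?_
  · have := h g (α g⁻¹ a)
    rwa [V, ← StarAlgEquiv.mul_apply, ← map_mul, mul_inv_cancel, map_one,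
      StarAlgEquiv.one_apply] at this
  · rw [CStarSeminorm.coe_add]
    exact W.add_mem hy hz

theorem eq_top_of_V_mem_of_dense_span {s : Set A} (hs : Dense (Submodule.span ℂ s : Set A))
    {W : Submodule ℂ (CrossedProduct α)} (hW : IsClosed (W : Set (CrossedProduct α)))
    (h : ∀ g, ∀ a ∈ s, V α g a ∈ W) : W = ⊤ := by
  refine eq_top_of_V_mem hW fun g a => ?_
  have hspan : Submodule.span ℂ s ≤ W.comap (VL α g).toLinearMap := Submodule.span_le.2 (h g)
  exact hs.induction (P := fun a => V α g a ∈ W) hspan (hW.preimage (VL α g).continuous) a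

end CrossedProduct

end CrossedProduct

section InductiveLimit

variable {ι : Type*} [Preorder ι] [IsDirectedOrder ι] [Nonempty ι] {F : ι → Type*}
  [∀ i, NonUnitalCStarAlgebra (F i)] {f : ∀ i j, i ≤ j → F i →⋆ₙₐ[ℂ] F j}
  [DirectedSystem F (f · · ·)]

section Lift

variable {C : Type*} [NonUnitalCStarAlgebra C] (φ : ∀ i, F i →⋆ₙₐ[ℂ] C)
  (hφ : ∀ i j h x, φ j (f i j h x) = φ i x)

/-- The universal property of the algebraic inductive limit. -/
def directLimitLift : DirectLimit F f →⋆ₙₐ[ℂ] C :=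
  let Φ : DirectLimit F f → C :=
    DirectLimit.lift f (fun i x => φ i x) fun i j h x => (hφ i j h x).symm
  have hΦ : ∀ i x, Φ (toDirectLimit f i x) = φ i x := fun _ _ => rfl
  { toFun := Φ
    map_smul' := fun c a => by
      obtain ⟨i, x, rfl⟩ := DirectLimit.exists_eq_mk _ a
      change Φ (c • toDirectLimit f i x) = c • Φ (toDirectLimit f i x)
      rw [← map_smul, hΦ, hΦ, map_smul]
    map_zero' := by
      rw [← map_zero (toDirectLimit f (Classical.arbitrary ι)), hΦ, map_zero]
    map_add' := fun a b => by
      obtain ⟨i, x, y, rfl, rfl⟩ := DirectLimit.exists_eq_mk₂ _ a b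
      change Φ (toDirectLimit f i x + toDirectLimit f i y) =
        Φ (toDirectLimit f i x) + Φ (toDirectLimit f i y)
      rw [← map_add, hΦ, hΦ, hΦ, map_add]
    map_mul' := fun a b => by
      obtain ⟨i, x, y, rfl, rfl⟩ := DirectLimit.exists_eq_mk₂ _ a b
      change Φ (toDirectLimit f i x * toDirectLimit f i y) =
        Φ (toDirectLimit f i x) * Φ (toDirectLimit f i y)
      rw [← map_mul, hΦ, hΦ, hΦ, map_mul]
    map_star' := fun a => by
      obtain ⟨i, x, rfl⟩ := DirectLimit.exists_eq_mk _ a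
      change Φ (star (toDirectLimit f i x)) = star (Φ (toDirectLimit f i x))
      rw [← map_star, hΦ, hΦ, map_star] }

/-- The universal property of the inductive limit. -/
def InductiveLimit.lift : InductiveLimit f →⋆ₙₐ[ℂ] C :=
  UniversalCStar.lift (directLimit_isBounded f) (directLimitLift φ hφ) fun _ h => h.elim

theorem InductiveLimit.lift_of (i : ι) (x : F i) : lift φ hφ (of f i x) = φ i x :=
  UniversalCStar.lift_coe (directLimit_isBounded f) (directLimitLift φ hφ) (fun _ h => h.elim)
    (toDirectLimit f i x)

end Lift

theorem InductiveLimit.of_map {i j : ι} (h : i ≤ j) (x : F i) : of f j (f i j h x) = of f i x :=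
  congrArg (maxSeminorm (directLimit_isBounded f)).toCompl (DirectLimit.mk_apply _ _ x h)

theorem InductiveLimit.denseRange_of :
    DenseRange fun p : Σ i, F i => (of f p.1 p.2 : InductiveLimit f) := fun x => by
  refine (maxSeminorm (directLimit_isBounded f)).ind (P := (· ∈ closure _)) x
    isClosed_closure fun a => ?_
  obtain ⟨i, x, rfl⟩ := DirectLimit.exists_eq_mk _ a
  exact subset_closure ⟨⟨i, x⟩, rfl⟩

section Norm

variable (hf : ∀ i j h, Function.Injective (f i j h))

/-- The norm of the algebraic inductive limit of a system with injective connecting maps. -/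
def directLimitNorm : DirectLimit F f → ℝ :=
  DirectLimit.lift f (fun _ x => ‖x‖) fun i j h x =>
    (NonUnitalStarAlgHom.norm_map _ (hf i j h) x).symm

theorem directLimitNorm_toDirectLimit (i : ι) (x : F i) :
    directLimitNorm hf (toDirectLimit f i x) = ‖x‖ := rfl

/-- The norm of the algebraic inductive limit as a C⋆-seminorm. -/
def directLimitSeminorm : CStarSeminorm (DirectLimit F f) where
  toSeminorm := Seminorm.ofSMulLE (directLimitNorm hf)
    (by
      rw [← map_zero (toDirectLimit f (Classical.arbitrary ι)), directLimitNorm_toDirectLimit,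
        norm_zero])
    (fun a b => by
      obtain ⟨i, x, y, rfl, rfl⟩ := DirectLimit.exists_eq_mk₂ _ a b
      change directLimitNorm hf (toDirectLimit f i x + toDirectLimit f i y) ≤ ‖x‖ + ‖y‖
      rw [← map_add]
      exact norm_add_le x y)
    (fun c a => by
      obtain ⟨i, x, rfl⟩ := DirectLimit.exists_eq_mk _ a
      change directLimitNorm hf (c • toDirectLimit f i x) ≤ ‖c‖ * ‖x‖
      rw [← map_smul]
      exact norm_smul_le c x)
  mul_le a b := by
    obtain ⟨i, x, y, rfl, rfl⟩ := DirectLimit.exists_eq_mk₂ _ a b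
    change directLimitNorm hf (toDirectLimit f i x * toDirectLimit f i y) ≤ ‖x‖ * ‖y‖
    rw [← map_mul]
    exact norm_mul_le x y
  star_mul_self a := by
    obtain ⟨i, x, rfl⟩ := DirectLimit.exists_eq_mk _ a
    change directLimitNorm hf (star (toDirectLimit f i x) * toDirectLimit f i x) = ‖x‖ ^ 2
    rw [← map_star, ← map_mul, sq]
    exact CStarRing.norm_star_mul_self

include hf in
theorem InductiveLimit.norm_of (i : ι) (x : F i) : ‖of f i x‖ = ‖x‖ :=
  le_antisymm (NonUnitalStarAlgHom.norm_apply_le (of f i) x) <|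
    ((directLimitSeminorm hf).le_maxSeminorm (directLimit_isBounded f) (fun _ h => h.elim)
      (toDirectLimit f i x)).trans_eq (CStarSeminorm.norm_coe _ _).symm

end Norm

end InductiveLimit

section FreeStarAlgebra

variable {X C : Type*} [Ring C] [StarRing C] [Algebra ℂ C]

namespace FreeStarAlgebra

/-- The universal property of the free ⋆-algebra. -/
def lift [StarModule ℂ C] (f : X → C) : FreeStarAlgebra X →⋆ₐ[ℂ] C :=
  let F : FreeStarAlgebra X →ₐ[ℂ] C := FreeAlgebra.lift ℂ (Sum.elim f fun x => star (f x))
  have hF : ∀ x, F (letter x) = Sum.elim f (fun x => star (f x)) x :=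
    FreeAlgebra.lift_ι_apply (Sum.elim f fun x => star (f x))
  { F with
    map_star' := fun a => by
      change F (star a) = star (F a)
      refine ind a (fun c => ?_) (fun x => ?_) (fun a b ha hb => ?_) fun a b ha hb => ?_
      · rw [star_algebraMap, AlgHom.commutes, AlgHom.commutes, algebraMap_star_comm]
      · rw [star_letter, hF, hF]
        cases x
        · rfl
        · exact (star_star _).symm
      · rw [star_mul, map_mul, ha, hb, map_mul, star_mul]
      · rw [star_add, map_add, ha, hb, map_add, star_add] }

theorem lift_gen [StarModule ℂ C] (f : X → C) (x : X) : lift f (gen x) = f x :=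
  FreeAlgebra.lift_ι_apply (Sum.elim f fun x => star (f x)) (Sum.inl x)

end FreeStarAlgebra

end FreeStarAlgebra

/-! ### Representations of the ring C⋆-algebra -/

section Corner

variable {A : Type*} [NonUnitalCStarAlgebra A] {p : A}

theorem mul_eq_self_of_mem_corner (hp : IsStarProjection p) {x : A}
    (hx : x ∈ corner p hp.isSelfAdjoint) : p * x = x ∧ x * p = x := by
  obtain ⟨a, rfl⟩ := hx
  constructor
  · rw [← mul_assoc, ← mul_assoc, hp.isIdempotentElem.eq]
  · rw [mul_assoc, hp.isIdempotentElem.eq]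

theorem mem_corner (hp : IsSelfAdjoint p) {x : A} (h₁ : p * x = x) (h₂ : x * p = x) :
    x ∈ corner p hp :=
  ⟨x, (congrArg (· * p) h₁).trans h₂⟩

variable (hp : IsStarProjection p)

/-- The ring structure of the corner of a projection `p`, with unit `p`. -/
abbrev cornerRing : Ring (corner p hp.isSelfAdjoint) where
  __ := (inferInstance : NonUnitalRing (corner p hp.isSelfAdjoint))
  one := ⟨p, mem_corner hp.isSelfAdjoint hp.isIdempotentElem hp.isIdempotentElem⟩
  one_mul x := Subtype.ext (mul_eq_self_of_mem_corner hp x.2).1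
  mul_one x := Subtype.ext (mul_eq_self_of_mem_corner hp x.2).2

/-- The algebra structure of the corner of a projection. -/
abbrev cornerAlgebra :
    letI := cornerRing hp
    Algebra ℂ (corner p hp.isSelfAdjoint) :=
  letI := cornerRing hp
  Algebra.ofModule smul_mul_assoc fun c x y => mul_smul_comm c x y

end Corner

/-- A representation of the defining relations of `𝔄[R]` in a C⋆-algebra `C`. The unit of `𝔄[R]`
is represented by a projection `e`, so that the relations are those of the corner `e C e`. -/
structure RingRep (R : Type*) [CommRing R] (C : Type*) [NonUnitalCStarAlgebra C] where
  e : C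
  s : R⁰ → C
  u : R → C
  isStarProjection_e : IsStarProjection e
  e_mul_s : ∀ m, e * s m = s m
  s_mul_e : ∀ m, s m * e = s m
  e_mul_u : ∀ n, e * u n = u n
  u_mul_e : ∀ n, u n * e = u n
  star_s_mul_s : ∀ m, star (s m) * s m = e
  star_u_mul_u : ∀ n, star (u n) * u n = e
  u_mul_star_u : ∀ n, u n * star (u n) = e
  s_mul_s : ∀ k m, s k * s m = s (k * m)
  u_mul_u : ∀ l n, u l * u n = u (l + n)
  s_mul_u : ∀ m n, s m * u n = u (m * n) * s m
  sum_eq : ∀ m : R⁰, ∑ᶠ q : R ⧸ Ideal.span {(m : R)},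
    u q.out * (s m * star (s m)) * u (-q.out) = e

section RingAlg

variable {R : Type*} [CommRing R] {C : Type*} [NonUnitalCStarAlgebra C]

namespace RingRep

variable (ρ : RingRep R C)

/-- The images of the generators, as elements of the corner. -/
def gen : Gen R → corner ρ.e ρ.isStarProjection_e.isSelfAdjoint
  | .s m => ⟨ρ.s m, mem_corner _ (ρ.e_mul_s m) (ρ.s_mul_e m)⟩
  | .u n => ⟨ρ.u n, mem_corner _ (ρ.e_mul_u n) (ρ.u_mul_e n)⟩

/-- The representation of the free ⋆-algebra in the corner. -/
def freeCorner :
    FreeStarAlgebra (Gen R) →⋆ₙₐ[ℂ] corner ρ.e ρ.isStarProjection_e.isSelfAdjoint :=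
  letI := cornerRing ρ.isStarProjection_e
  letI := cornerAlgebra ρ.isStarProjection_e
  (FreeStarAlgebra.lift ρ.gen).toNonUnitalStarAlgHom

/-- The representation of the free ⋆-algebra, which sends the unit to `e`. -/
def free : FreeStarAlgebra (Gen R) →⋆ₙₐ[ℂ] C :=
  (NonUnitalStarSubalgebraClass.subtype
    (corner ρ.e ρ.isStarProjection_e.isSelfAdjoint)).comp ρ.freeCorner

theorem free_gen (x : Gen R) : ρ.free (.gen x) = ρ.gen x :=
  letI := cornerRing ρ.isStarProjection_e
  letI := cornerAlgebra ρ.isStarProjection_e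
  congrArg Subtype.val (FreeStarAlgebra.lift_gen ρ.gen x)

theorem free_s (m : R⁰) : ρ.free (fs m) = ρ.s m := ρ.free_gen (.s m)

theorem free_u (n : R) : ρ.free (fu n) = ρ.u n := ρ.free_gen (.u n)

theorem free_one : ρ.free 1 = ρ.e :=
  letI := cornerRing ρ.isStarProjection_e
  letI := cornerAlgebra ρ.isStarProjection_e
  congrArg Subtype.val (map_one (FreeStarAlgebra.lift ρ.gen))

variable [∀ m : R⁰, Finite (R ⧸ Ideal.span {(m : R)})]

theorem free_eq_zero_of_rel {x : FreeStarAlgebra (Gen R)} (hx : Rel R x) : ρ.free x = 0 := by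
  cases hx with
  | isometry m => rw [map_sub, map_mul, map_star, free_s, free_one, star_s_mul_s, sub_self]
  | unitary_left n => rw [map_sub, map_mul, map_star, free_u, free_one, star_u_mul_u, sub_self]
  | unitary_right n => rw [map_sub, map_mul, map_star, free_u, free_one, u_mul_star_u, sub_self]
  | s_mul k m => rw [map_sub, map_mul, free_s, free_s, free_s, s_mul_s, sub_self]
  | u_mul k m => rw [map_sub, map_mul, free_u, free_u, free_u, u_mul_u, sub_self]
  | s_mul_u m n => rw [map_sub, map_mul, map_mul, free_u, free_u, free_s, s_mul_u, sub_self]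
  | sum_eq_one m =>
    rw [map_sub, free_one, map_finsum ρ.free (Set.toFinite _), ← ρ.sum_eq m, sub_eq_zero]
    simp only [map_mul, map_star, free_u, free_s]

/-- The representation of `𝔄[R]` defined by elements that satisfy the relations. -/
def lift : RingAlg R →⋆ₙₐ[ℂ] C :=
  UniversalCStar.lift (rel_isBounded R) ρ.free fun _ => ρ.free_eq_zero_of_rel

theorem lift_of (x : FreeStarAlgebra (Gen R)) : ρ.lift (RingAlg.of x) = ρ.free x :=
  UniversalCStar.lift_coe (rel_isBounded R) ρ.free (fun _ => ρ.free_eq_zero_of_rel) x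

theorem lift_s (m : R⁰) : ρ.lift (RingAlg.s m) = ρ.s m := (ρ.lift_of _).trans (ρ.free_s m)

theorem lift_u (n : R) : ρ.lift (RingAlg.u n) = ρ.u n := (ρ.lift_of _).trans (ρ.free_u n)

theorem lift_one : ρ.lift 1 = ρ.e := (ρ.lift_of _).trans ρ.free_one

end RingRep

namespace RingAlg

theorem hom_ext {φ ψ : RingAlg R →⋆ₙₐ[ℂ] C} (hs : ∀ m, φ (s m) = ψ (s m))
    (hu : ∀ n, φ (u n) = ψ (u n)) : φ = ψ := by
  refine CStarSeminorm.hom_ext (maxSeminorm (rel_isBounded R)) fun a => ?_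
  change φ (of a) = ψ (of a)
  have hgen : ∀ x : Gen R, φ (of (.gen x)) = ψ (of (.gen x))
    | .s m => hs m
    | .u n => hu n
  have hone : φ 1 = ψ 1 := s_one (R := R) ▸ hs 1
  refine FreeStarAlgebra.ind a (fun c => ?_) ?_ (fun a b ha hb => ?_) fun a b ha hb => ?_
  · rw [Algebra.algebraMap_eq_smul_one, map_smul, map_smul, map_smul]
    exact congrArg (c • ·) hone
  · rintro (x | x)
    · exact hgen x
    · change φ (of (.letter (Sum.swap (.inl x)))) = ψ (of (.letter (Sum.swap (.inl x))))
      rw [← FreeStarAlgebra.star_letter, map_star, map_star, map_star]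
      exact congrArg star (hgen x)
  · rw [map_mul, map_mul, map_mul, ha, hb]
  · rw [map_add, map_add, map_add, ha, hb]

theorem isSelfAdjoint_one : IsSelfAdjoint (1 : RingAlg R) :=
  (IsSelfAdjoint.one (FreeStarAlgebra (Gen R))).map of

theorem mul_one' (x : RingAlg R) : x * 1 = x := by
  rw [← star_star (x * 1), star_mul, isSelfAdjoint_one.star_eq, one_mul', star_star]

theorem isStarProjection_one : IsStarProjection (1 : RingAlg R) :=
  ⟨one_mul' 1, isSelfAdjoint_one⟩

theorem star_u_mul_u (n : R) : star (u n) * u n = (1 : RingAlg R) := by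
  rw [u, ← map_star, ← map_mul]
  exact of_eq (Rel.unitary_left n)

theorem u_mul_star_u (n : R) : u n * star (u n) = (1 : RingAlg R) := by
  rw [u, ← map_star, ← map_mul]
  exact of_eq (Rel.unitary_right n)

theorem u_mul_u (l n : R) : u l * u n = (u (l + n) : RingAlg R) := by
  rw [u, u, ← map_mul]
  exact of_eq (Rel.u_mul l n)

theorem s_mul_u (m : R⁰) (n : R) : s m * u n = (u (m * n) * s m : RingAlg R) := by
  rw [s, u, u, ← map_mul, ← map_mul]
  exact of_eq (Rel.s_mul_u m n)

theorem u_zero : (u 0 : RingAlg R) = 1 := by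
  rw [← one_mul' (u 0), ← star_u_mul_u (0 : R), mul_assoc, u_mul_u, add_zero]

theorem star_u (n : R) : star (u n) = (u (-n) : RingAlg R) := by
  rw [← mul_one' (star (u n)), ← u_zero, ← add_neg_cancel n, ← u_mul_u, ← mul_assoc, star_u_mul_u,
    one_mul']

theorem sum_eq_one (m : R⁰) [Fintype (R ⧸ Ideal.span {(m : R)})] :
    ∑ q : R ⧸ Ideal.span {(m : R)}, u q.out * (s m * star (s m)) * star (u q.out) =
      (1 : RingAlg R) := by
  refine Eq.trans ?_ (of_eq (Rel.sum_eq_one m))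
  rw [finsum_eq_sum_of_fintype, map_sum]
  refine Finset.sum_congr rfl fun q _ => ?_
  rw [star_u, map_mul, map_mul, map_mul, map_star]
  rfl

theorem norm_le_one_of_star_mul_self {x : RingAlg R} (hx : star x * x = 1) : ‖x‖ ≤ 1 :=
  norm_le_one_of_isStarProjection_star_mul_self (hx ▸ isStarProjection_one)

theorem star_s_mul_s_mul (m : R⁰) (x : RingAlg R) : star (s m) * (s m * x) = x := by
  rw [← mul_assoc, star_s_mul_s, one_mul']

theorem star_s_mul_conj_mul_s (m : R⁰) (x : RingAlg R) : star (s m) * conj m x * s m = x := by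
  change star (s m) * (s m * x * star (s m)) * s m = x
  rw [mul_assoc (s m), star_s_mul_s_mul, mul_assoc, star_s_mul_s, mul_one']

theorem conj_injective (m : R⁰) : Function.Injective (conj m : RingAlg R → RingAlg R) :=
  Function.LeftInverse.injective (g := fun x => star (s m) * x * s m) (star_s_mul_conj_mul_s m)

end RingAlg

end RingAlg

namespace StableAlg

variable {R : Type*} [CommRing R]

theorem of_eq_of_mul (k l : R⁰) (x : RingAlg R) :
    of k x = of (l * k) (RingAlg.s l * x * star (RingAlg.s l)) := by
  have h : (⟨k⟩ : DivIndex R) ≤ ⟨l * k⟩ := ⟨l, rfl⟩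
  refine (InductiveLimit.of_map (f := connect) h x).symm.trans ?_
  rw [connect_eq ⟨k⟩ ⟨l * k⟩ h l rfl]
  rfl

theorem denseRange_of : DenseRange fun p : R⁰ × RingAlg R => of p.1 p.2 :=
  (InductiveLimit.denseRange_of (f := connect)).mono <| by
    rintro _ ⟨⟨i, x⟩, rfl⟩
    exact ⟨(i.val, x), rfl⟩

theorem norm_of (k : R⁰) (x : RingAlg R) : ‖of k x‖ = ‖x‖ :=
  InductiveLimit.norm_of (f := connect) (fun _ _ h => RingAlg.conj_injective h.choose) ⟨k⟩ x

section Lift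

variable {C : Type*} [NonUnitalCStarAlgebra C] (φ : R⁰ → RingAlg R →⋆ₙₐ[ℂ] C)
  (h : ∀ k l x, φ (l * k) (RingAlg.conj l x) = φ k x)

/-- The universal property of the stabilization. -/
def lift : StableAlg R →⋆ₙₐ[ℂ] C :=
  InductiveLimit.lift (f := connect) (fun i : DivIndex R => φ i.val) fun i j hij x => by
    obtain ⟨l, hl⟩ := id hij
    rw [connect_eq i j hij l hl, hl, h]

theorem lift_of (k : R⁰) (x : RingAlg R) : lift φ h (of k x) = φ k x :=
  InductiveLimit.lift_of (f := connect) (fun i : DivIndex R => φ i.val) _ ⟨k⟩ x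

end Lift

end StableAlg

/-! ### Multipliers as strict limits -/

section Strict

open Filter Topology
open scoped MultiplierAlgebra

theorem exists_tendsto_of_dense {𝕜 E F ι : Type*} [NontriviallyNormedField 𝕜]
    [NormedAddCommGroup E] [NormedSpace 𝕜 E] [NormedAddCommGroup F] [NormedSpace 𝕜 F]
    [CompleteSpace F] {l : Filter ι} [l.NeBot] {f : ι → E →L[𝕜] F} {C : ℝ} (hC : ∀ i, ‖f i‖ ≤ C)
    {D : Set E} (hD : Dense D) (h : ∀ x ∈ D, ∃ y, Tendsto (fun i => f i x) l (𝓝 y)) :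
    ∃ T : E →L[𝕜] F, ∀ x, Tendsto (fun i => f i x) l (𝓝 (T x)) := by
  have hcauchy : ∀ x, ∃ y, Tendsto (fun i => f i x) l (𝓝 y) := by
    intro x
    rw [← cauchy_map_iff_exists_tendsto, Metric.cauchy_iff]
    refine ⟨inferInstance, fun ε hε => ?_⟩
    obtain ⟨z, hxz, hzD⟩ : ∃ z, C * ‖x - z‖ < ε / 4 ∧ z ∈ D :=
      hD.inter_open_nonempty {z | C * ‖x - z‖ < ε / 4}
        (isOpen_lt (by fun_prop) continuous_const) ⟨x, by simpa using hε⟩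
    obtain ⟨y, hy⟩ := h z hzD
    have hdist : ∀ i, dist (f i x) (f i z) < ε / 4 := fun i => by
      rw [dist_eq_norm, ← map_sub]
      exact ((f i).le_of_opNorm_le (hC i) _).trans_lt hxz
    refine ⟨_, image_mem_map (Metric.tendsto_nhds.1 hy (ε / 4) (by positivity)), ?_⟩
    rintro _ ⟨i, hi, rfl⟩ _ ⟨j, hj, rfl⟩
    calc dist (f i x) (f j x)
        ≤ dist (f i x) (f i z) + dist (f i z) (f j z) + dist (f j z) (f j x) :=
          dist_triangle4 _ _ _ _
      _ ≤ dist (f i x) (f i z) + (dist (f i z) y + dist (f j z) y) + dist (f j x) (f j z) := by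
          rw [dist_comm (f j z) (f j x)]
          gcongr
          exact dist_triangle_right _ _ _
      _ < ε / 4 + (ε / 4 + ε / 4) + ε / 4 := by
          gcongr
          exacts [hdist i, hi, hj, hdist j]
      _ = ε := by ring
  choose T hT using hcauchy
  let T' : E →ₗ[𝕜] F :=
    { toFun := T
      map_add' := fun x y => tendsto_nhds_unique (hT (x + y)) <| by
        simpa only [map_add] using (hT x).add (hT y)
      map_smul' := fun c x => tendsto_nhds_unique (hT (c • x)) <| by
        simpa only [map_smul, RingHom.id_apply] using (hT x).const_smul c }
  exact ⟨T'.mkContinuous C fun x => le_of_tendsto (hT x).norm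
    (Eventually.of_forall fun i => (f i).le_of_opNorm_le (hC i) x), hT⟩

variable {A : Type*} [NonUnitalCStarAlgebra A]

theorem exists_multiplier {ι κ : Type*} {l : Filter ι} [l.NeBot] {a : ι → A} {C : ℝ}
    (hC : ∀ i, ‖a i‖ ≤ C) {d L M : κ → A} (hd : DenseRange d)
    (hL : ∀ k, Tendsto (fun i => a i * d k) l (𝓝 (L k)))
    (hM : ∀ k, Tendsto (fun i => d k * a i) l (𝓝 (M k))) :
    ∃ T : 𝓜(ℂ, A), ∀ k, T.fst (d k) = L k ∧ T.snd (d k) = M k := by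
  obtain ⟨F, hF⟩ := exists_tendsto_of_dense (f := fun i => ContinuousLinearMap.mul ℂ A (a i))
    (fun i => (ContinuousLinearMap.opNorm_mul_apply_le ℂ A (a i)).trans (hC i)) hd
    (Set.forall_mem_range.2 fun k => ⟨L k, hL k⟩)
  obtain ⟨G, hG⟩ := exists_tendsto_of_dense
    (f := fun i => (ContinuousLinearMap.mul ℂ A).flip (a i))
    (fun i => (ContinuousLinearMap.opNorm_le_bound _ (norm_nonneg _) fun x =>
      (norm_mul_le x (a i)).trans_eq (mul_comm _ _)).trans (hC i)) hd
    (Set.forall_mem_range.2 fun k => ⟨M k, hM k⟩)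
  refine ⟨⟨(F, G), fun x y => ?_⟩, fun k =>
    ⟨tendsto_nhds_unique (hF _) (hL k), tendsto_nhds_unique (hG _) (hM k)⟩⟩
  have h₁ : Tendsto (fun i => x * a i * y) l (𝓝 (G x * y)) := (hG x).mul_const y
  have h₂ : Tendsto (fun i => x * (a i * y)) l (𝓝 (x * F y)) := (hF y).const_mul x
  simp only [← mul_assoc] at h₂
  exact tendsto_nhds_unique h₁ h₂

theorem multiplier_ext {κ : Type*} {d : κ → A} (hd : DenseRange d) {T T' : 𝓜(ℂ, A)}
    (h : ∀ k, T.fst (d k) = T'.fst (d k)) : T = T' := by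
  have hfst : T.fst = T'.fst := DFunLike.coe_injective
    (hd.equalizer T.fst.continuous T'.fst.continuous (funext h))
  rw [← sub_eq_zero, ← norm_eq_zero, ← DoubleCentralizer.norm_fst, DoubleCentralizer.sub_fst, hfst,
    sub_self, norm_zero]

theorem multiplier_mul_coe (T : 𝓜(ℂ, A)) (a : A) :
    T * DoubleCentralizer.coeHom a = DoubleCentralizer.coeHom (𝕜 := ℂ) (T.fst a) := by
  refine multiplier_ext denseRange_id fun x => ?_
  change T.fst (a * x) = T.fst a * x
  have h : ∀ z : A, z * T.fst (a * x) = z * (T.fst a * x) := fun z => by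
    rw [← T.central, ← mul_assoc, T.central, mul_assoc]
  rw [← sub_eq_zero, ← CStarRing.star_mul_self_eq_zero_iff, mul_sub, h, sub_self]

theorem coe_mul_multiplier (T : 𝓜(ℂ, A)) (a : A) :
    DoubleCentralizer.coeHom a * T = DoubleCentralizer.coeHom (𝕜 := ℂ) (T.snd a) :=
  multiplier_ext denseRange_id fun x => (T.central a x).symm

theorem coeHom_injective :
    Function.Injective (DoubleCentralizer.coeHom : A →⋆ₙₐ[ℂ] 𝓜(ℂ, A)) := by
  refine (injective_iff_map_eq_zero _).2 fun a ha => (CStarRing.mul_star_self_eq_zero_iff a).1 ?_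
  exact congrArg (fun T : 𝓜(ℂ, A) => T.fst (star a)) ha

end Strict

/-! ### The implementing unitaries in the multiplier algebra of the stabilization -/

namespace RingAlg

variable {R : Type*} [CommRing R]

theorem star_s_mul_mul_s (l m : R⁰) :
    star (s (l * m)) * s m = (star (s l) : RingAlg R) := by
  rw [mul_comm, ← s_mul_s, star_mul, mul_assoc, star_s_mul_s, mul_one']

theorem star_s_mul_u (l : R⁰) (n : R) :
    star (s l) * u (l * n) = (u n * star (s l) : RingAlg R) := by
  have h := congrArg star (s_mul_u l (-n))
  rw [star_mul, star_mul, mul_neg, star_u, star_u, neg_neg, neg_neg] at h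
  exact h.symm

end RingAlg

namespace StableAlg

open Filter Topology
open scoped MultiplierAlgebra
open DoubleCentralizer (coeHom)

variable {R : Type*} [CommRing R]

theorem of_s_mul_of {k : R⁰} {i : DivIndex R} (hi : ⟨k⟩ ≤ i) (m : R⁰) (y : RingAlg R) :
    of i.val (.s m) * of k y = of k (.s m * y) := by
  obtain ⟨l, hl⟩ := hi
  rw [hl, of_eq_of_mul k l, of_eq_of_mul k l, ← map_mul, ← mul_assoc, ← mul_assoc,
    ← mul_assoc, RingAlg.s_mul_s, RingAlg.s_mul_s, mul_comm l m]

theorem of_mul_of_s {k m : R⁰} {i : DivIndex R} (hi : ⟨m * k⟩ ≤ i) (y : RingAlg R) :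
    of k y * of i.val (.s m) = of (m * k) (.s m * y) := by
  obtain ⟨l, hl⟩ := hi
  rw [hl, of_eq_of_mul (m * k) l, of_eq_of_mul k (l * m), mul_assoc l, ← map_mul,
    mul_assoc _ (star _), RingAlg.star_s_mul_mul_s, ← RingAlg.s_mul_s, mul_assoc (RingAlg.s l)]

theorem of_u_mul_of {k : R⁰} {i : DivIndex R} (hi : ⟨k⟩ ≤ i) (n : R) (y : RingAlg R) :
    of i.val (.u (i.val * n)) * of k y = of k (.u (k * n) * y) := by
  obtain ⟨l, hl⟩ := hi
  rw [hl, of_eq_of_mul k l, of_eq_of_mul k l, ← map_mul, ← mul_assoc, ← mul_assoc,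
    ← mul_assoc, RingAlg.s_mul_u, Submonoid.coe_mul, mul_assoc (l : R)]

theorem of_mul_of_u {k : R⁰} {i : DivIndex R} (hi : ⟨k⟩ ≤ i) (n : R) (y : RingAlg R) :
    of k y * of i.val (.u (i.val * n)) = of k (y * .u (k * n)) := by
  obtain ⟨l, hl⟩ := hi
  rw [hl, of_eq_of_mul k l, of_eq_of_mul k l, ← map_mul, Submonoid.coe_mul,
    mul_assoc (l : R), mul_assoc _ (star _), RingAlg.star_s_mul_u]
  simp only [mul_assoc]

theorem exists_dilation (m : R⁰) : ∃ T : 𝓜(ℂ, StableAlg R), ∀ p : R⁰ × RingAlg R,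
    T.fst (of p.1 p.2) = of p.1 (.s m * p.2) ∧
      T.snd (of p.1 p.2) = of (m * p.1) (.s m * p.2) := by
  have hnorm (i : DivIndex R) : ‖of i.val (.s m)‖ ≤ 1 :=
    (norm_of _ _).trans_le (RingAlg.norm_le_one_of_star_mul_self (RingAlg.star_s_mul_s m))
  have hleft (p : R⁰ × RingAlg R) :
      Tendsto (fun i : DivIndex R => of i.val (.s m) * of p.1 p.2) atTop
        (𝓝 (of p.1 (.s m * p.2))) := by
    refine tendsto_const_nhds.congr' ?_
    filter_upwards [eventually_ge_atTop ⟨p.1⟩] with i hi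
    exact (of_s_mul_of hi m p.2).symm
  have hright (p : R⁰ × RingAlg R) :
      Tendsto (fun i : DivIndex R => of p.1 p.2 * of i.val (.s m)) atTop
        (𝓝 (of (m * p.1) (.s m * p.2))) := by
    refine tendsto_const_nhds.congr' ?_
    filter_upwards [eventually_ge_atTop ⟨m * p.1⟩] with i hi
    exact (of_mul_of_s hi p.2).symm
  exact exists_multiplier hnorm denseRange_of hleft hright

theorem exists_translation (n : R) : ∃ T : 𝓜(ℂ, StableAlg R), ∀ p : R⁰ × RingAlg R,
    T.fst (of p.1 p.2) = of p.1 (.u (p.1 * n) * p.2) ∧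
      T.snd (of p.1 p.2) = of p.1 (p.2 * .u (p.1 * n)) := by
  have hnorm (i : DivIndex R) : ‖of i.val (.u (i.val * n))‖ ≤ 1 :=
    (norm_of _ _).trans_le (RingAlg.norm_le_one_of_star_mul_self (RingAlg.star_u_mul_u _))
  have hleft (p : R⁰ × RingAlg R) :
      Tendsto (fun i : DivIndex R => of i.val (.u (i.val * n)) * of p.1 p.2) atTop
        (𝓝 (of p.1 (.u (p.1 * n) * p.2))) := by
    refine tendsto_const_nhds.congr' ?_
    filter_upwards [eventually_ge_atTop ⟨p.1⟩] with i hi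
    exact (of_u_mul_of hi n p.2).symm
  have hright (p : R⁰ × RingAlg R) :
      Tendsto (fun i : DivIndex R => of p.1 p.2 * of i.val (.u (i.val * n))) atTop
        (𝓝 (of p.1 (p.2 * .u (p.1 * n)))) := by
    refine tendsto_const_nhds.congr' ?_
    filter_upwards [eventually_ge_atTop ⟨p.1⟩] with i hi
    exact (of_mul_of_u hi n p.2).symm
  exact exists_multiplier hnorm denseRange_of hleft hright

/-- The multiplier of `𝔄(R)` which implements the dilation by `m`: the strict limit of the
elements `s_m` of the copies of `𝔄[R]`. -/
def dil (m : R⁰) : 𝓜(ℂ, StableAlg R) := (exists_dilation m).choose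

/-- The multiplier of `𝔄(R)` which implements the translation by `n`: the strict limit of the
elements `u^{kn}` of the copies `𝔄(R)_k`. -/
def trans (n : R) : 𝓜(ℂ, StableAlg R) := (exists_translation n).choose

theorem dil_fst (m k : R⁰) (y : RingAlg R) : (dil m).fst (of k y) = of k (.s m * y) :=
  ((exists_dilation m).choose_spec (k, y)).1

theorem dil_snd (m k : R⁰) (y : RingAlg R) : (dil m).snd (of k y) = of (m * k) (.s m * y) :=
  ((exists_dilation m).choose_spec (k, y)).2

theorem trans_fst (n : R) (k : R⁰) (y : RingAlg R) :
    (trans n).fst (of k y) = of k (.u (k * n) * y) :=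
  ((exists_translation n).choose_spec (k, y)).1

theorem trans_snd (n : R) (k : R⁰) (y : RingAlg R) :
    (trans n).snd (of k y) = of k (y * .u (k * n)) :=
  ((exists_translation n).choose_spec (k, y)).2

theorem star_dil_fst (m k : R⁰) (y : RingAlg R) :
    (star (dil m)).fst (of k y) = of (m * k) (y * star (.s m)) := by
  rw [DoubleCentralizer.star_fst, ← map_star (of k), dil_snd, ← map_star, star_mul, star_star]

theorem star_trans_fst (n : R) (k : R⁰) (y : RingAlg R) :
    (star (trans n)).fst (of k y) = of k (star (.u (k * n)) * y) := by
  rw [DoubleCentralizer.star_fst, ← map_star (of k), trans_snd, ← map_star, star_mul, star_star]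

theorem multiplier_ext_of {T T' : 𝓜(ℂ, StableAlg R)}
    (h : ∀ k y, T.fst (of k y) = T'.fst (of k y)) : T = T' :=
  multiplier_ext denseRange_of fun p => h p.1 p.2

theorem mul_fst_apply (T T' : 𝓜(ℂ, StableAlg R)) (x : StableAlg R) :
    (T * T').fst x = T.fst (T'.fst x) := rfl

theorem one_fst_apply (x : StableAlg R) : (1 : 𝓜(ℂ, StableAlg R)).fst x = x := rfl

theorem dil_mem_unitary (m : R⁰) : dil m ∈ unitary 𝓜(ℂ, StableAlg R) := by
  constructor <;> refine multiplier_ext_of fun k y => ?_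
  · rw [mul_fst_apply, dil_fst, star_dil_fst, ← of_eq_of_mul, one_fst_apply]
  · rw [mul_fst_apply, star_dil_fst, dil_fst, ← mul_assoc, ← of_eq_of_mul, one_fst_apply]

theorem trans_mem_unitary (n : R) : trans n ∈ unitary 𝓜(ℂ, StableAlg R) := by
  constructor <;> refine multiplier_ext_of fun k y => ?_
  · rw [mul_fst_apply, trans_fst, star_trans_fst, ← mul_assoc, RingAlg.star_u_mul_u,
      RingAlg.one_mul', one_fst_apply]
  · rw [mul_fst_apply, star_trans_fst, trans_fst, ← mul_assoc, RingAlg.u_mul_star_u,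
      RingAlg.one_mul', one_fst_apply]

variable (R) in
/-- The unitary multipliers of `𝔄(R)` which implement the dilations. -/
def dilHom : R⁰ →* unitary 𝓜(ℂ, StableAlg R) where
  toFun m := ⟨dil m, dil_mem_unitary m⟩
  map_one' := Subtype.ext <| multiplier_ext_of fun k y => by
    rw [dil_fst, RingAlg.s_one, RingAlg.one_mul', OneMemClass.coe_one, one_fst_apply]
  map_mul' m n := Subtype.ext <| multiplier_ext_of fun k y => by
    rw [Submonoid.coe_mul, mul_fst_apply, dil_fst, dil_fst, dil_fst, ← mul_assoc, RingAlg.s_mul_s]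

variable (R) in
/-- The unitary multipliers of `𝔄(R)` which implement the translations. -/
def transHom : Multiplicative R →* unitary 𝓜(ℂ, StableAlg R) where
  toFun n := ⟨trans n.toAdd, trans_mem_unitary n.toAdd⟩
  map_one' := Subtype.ext <| multiplier_ext_of fun k y => by
    rw [trans_fst, toAdd_one, mul_zero, RingAlg.u_zero, RingAlg.one_mul', OneMemClass.coe_one,
      one_fst_apply]
  map_mul' m n := Subtype.ext <| multiplier_ext_of fun k y => by
    rw [Submonoid.coe_mul, mul_fst_apply, trans_fst, trans_fst, trans_fst, ← mul_assoc,
      RingAlg.u_mul_u, toAdd_mul, mul_add]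

theorem dilHom_mul_transHom (m : R⁰) (n : R) :
    dilHom R m * transHom R (Multiplicative.ofAdd n) =
      transHom R (Multiplicative.ofAdd (m * n)) * dilHom R m :=
  Subtype.ext <| multiplier_ext_of fun k y => by
    change (dil m).fst ((trans n).fst (of k y)) = (trans (m * n)).fst ((dil m).fst (of k y))
    rw [dil_fst, trans_fst, trans_fst, dil_fst, ← mul_assoc, ← mul_assoc, RingAlg.s_mul_u,
      mul_left_comm]

theorem star_dil_mul_of_one_mul_dil (k : R⁰) (x : RingAlg R) :
    star (dil k) * coeHom (of 1 x) * dil k = coeHom (𝕜 := ℂ) (of k x) := by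
  rw [multiplier_mul_coe, star_dil_fst, coe_mul_multiplier, dil_snd, mul_one, ← mul_assoc,
    ← of_eq_of_mul]

theorem of_one_mul_mul_of_one_mem_range (a : StableAlg R) :
    of 1 1 * a * of 1 1 ∈ Set.range (of (1 : R⁰)) := by
  have hc : IsClosed (Set.range (of (1 : R⁰))) :=
    (AddMonoidHomClass.isometry_of_norm _ (norm_of (1 : R⁰))).isClosedEmbedding.isClosed_range
  refine denseRange_of.induction_on (p := fun a => of 1 1 * a * of 1 1 ∈ Set.range (of 1)) a
    (hc.preimage (by fun_prop)) fun ⟨k, x⟩ => ⟨star (.s k) * x * .s k, ?_⟩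
  rw [of_eq_of_mul 1 k, of_eq_of_mul 1 k, mul_one, ← map_mul, ← map_mul, RingAlg.mul_one']
  simp only [mul_assoc]

end StableAlg

/-! ### The `ax + b`-group of the quotient field -/

section AffineGroup

variable {R : Type*} [CommRing R] {H : Type*} [Group H] (S : R⁰ →* H) (T : Multiplicative R →* H)

/-- The element `S(d)⁻¹ T(r) S(c)`. If `S` and `T` are the dilations and the translations of an
affine group, then it is the map `x ↦ (c x + r) / d`. -/
def affineVal (d c : R⁰) (r : R) : H := (S d)⁻¹ * (T (.ofAdd r) * S c)

section Semiconj

variable {S T} (hST : ∀ (m : R⁰) (n : R), S m * T (.ofAdd n) = T (.ofAdd (m * n)) * S m)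

include hST

theorem affineVal_mul_left (l d c : R⁰) (r : R) :
    affineVal S T (l * d) (l * c) (l * r) = affineVal S T d c r := by
  rw [affineVal, affineVal, map_mul S l c, ← mul_assoc (T _), ← hST, map_mul S l d]
  group

theorem affineVal_mul (d c d' c' : R⁰) (r r' : R) :
    affineVal S T d c r * affineVal S T d' c' r' =
      affineVal S T (d' * d) (c * c') (d' * r + c * r') := by
  have hSS : S c * (S d')⁻¹ = (S d')⁻¹ * S c := by
    rw [mul_inv_eq_iff_eq_mul, mul_assoc, ← map_mul, mul_comm, map_mul, inv_mul_cancel_left]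
  have hTS : T (.ofAdd r) * (S d')⁻¹ = (S d')⁻¹ * T (.ofAdd (d' * r)) := by
    rw [mul_inv_eq_iff_eq_mul, mul_assoc, ← hST, inv_mul_cancel_left]
  simp only [affineVal, map_mul, ofAdd_add, mul_inv_rev]
  calc (S d)⁻¹ * (T (.ofAdd r) * S c) * ((S d')⁻¹ * (T (.ofAdd r') * S c'))
      = (S d)⁻¹ * (T (.ofAdd r) * (S c * (S d')⁻¹)) * (T (.ofAdd r') * S c') := by group
    _ = (S d)⁻¹ * (T (.ofAdd r) * (S d')⁻¹ * S c) * (T (.ofAdd r') * S c') := by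
      rw [hSS, mul_assoc (T _)]
    _ = (S d)⁻¹ * (S d')⁻¹ * T (.ofAdd (d' * r)) * (S c * T (.ofAdd r')) * S c' := by
      rw [hTS]
      group
    _ = (S d)⁻¹ * (S d')⁻¹ * (T (.ofAdd (d' * r)) * T (.ofAdd (c * r')) * (S c * S c')) := by
      rw [hST]
      group

end Semiconj

variable [IsDomain R]

variable (R) in
/-- The integral dilations, as a homomorphism. -/
def dilationHom : R⁰ →* AffineGroup (FractionRing R) where
  toFun := dilationBy
  map_one' := by
    rw [AffineGroup.one_def]
    ext <;> simp [dilationBy]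
  map_mul' m n := by
    rw [AffineGroup.mul_def]
    ext <;> simp [dilationBy]

variable (R) in
/-- The integral translations, as a homomorphism. -/
def translationHom : Multiplicative R →* AffineGroup (FractionRing R) where
  toFun n := translationBy n.toAdd
  map_one' := by
    rw [AffineGroup.one_def]
    ext <;> simp [translationBy]
  map_mul' m n := by
    rw [AffineGroup.mul_def]
    ext <;> simp [translationBy, add_comm]

theorem dilationBy_mul (m n : R⁰) : dilationBy (m * n) = dilationBy m * dilationBy n :=
  map_mul (dilationHom R) m n

theorem translationBy_add (m n : R) :
    translationBy (m + n) = translationBy m * translationBy n :=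
  map_mul (translationHom R) (.ofAdd m) (.ofAdd n)

theorem translationBy_neg (n : R) : translationBy (-n) = (translationBy n)⁻¹ :=
  map_inv (translationHom R) (.ofAdd n)

theorem dilationBy_mul_translationBy (m : R⁰) (n : R) :
    dilationBy m * translationBy n = translationBy (m * n) * dilationBy m := by
  rw [AffineGroup.mul_def, AffineGroup.mul_def]
  ext <;> simp [translationBy, dilationBy]

theorem dilationBy_one : dilationBy (1 : R⁰) = 1 :=
  map_one (dilationHom R)

/-- The integral affine map `x ↦ m x + n`. -/
def affineBy (m : R⁰) (n : R) : AffineGroup (FractionRing R) := translationBy n * dilationBy m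

theorem affineBy_mul (m m' : R⁰) (n n' : R) :
    affineBy m n * affineBy m' n' = affineBy (m * m') (n + m * n') := by
  rw [affineBy, affineBy, affineBy, translationBy_add, dilationBy_mul, mul_assoc, mul_assoc,
    ← mul_assoc (dilationBy m), dilationBy_mul_translationBy, mul_assoc]

theorem affineBy_one (n : R) : affineBy 1 n = translationBy n := by
  rw [affineBy, dilationBy_one, mul_one]

theorem affineBy_zero (m : R⁰) : affineBy m (0 : R) = dilationBy m := by
  have hzero : translationBy (0 : R) = 1 := map_one (translationHom R)
  rw [affineBy, hzero, one_mul]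

theorem affineBy_inj {m m' : R⁰} {n n' : R} (h : affineBy m n = affineBy m' n') :
    m = m' ∧ n = n' := by
  have ha := congrArg (fun g => (g.a : FractionRing R)) h
  have hb := congrArg AffineGroup.b h
  simp only [affineBy, AffineGroup.mul_def, translationBy, dilationBy, one_mul, mul_zero, zero_add,
    IsUnit.unit_spec] at ha hb
  exact ⟨Subtype.ext (IsFractionRing.injective R (FractionRing R) ha),
    IsFractionRing.injective R (FractionRing R) hb⟩

theorem affineVal_dilationHom_translationHom (d c : R⁰) (r : R) :
    affineVal (dilationHom R) (translationHom R) d c r = (dilationBy d)⁻¹ * affineBy c r := rfl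

theorem inv_mul_affineBy_mul_left (l d c : R⁰) (r : R) :
    (dilationBy (l * d))⁻¹ * affineBy (l * c) (l * r) = (dilationBy d)⁻¹ * affineBy c r := by
  simp only [← affineVal_dilationHom_translationHom]
  exact affineVal_mul_left dilationBy_mul_translationBy l d c r

theorem exists_eq_inv_mul_affineBy (g : AffineGroup (FractionRing R)) :
    ∃ d c r, g = (dilationBy d)⁻¹ * affineBy c r := by
  obtain ⟨⟨x, d₁⟩, hx⟩ := IsLocalization.surj R⁰ (g.a : FractionRing R)
  obtain ⟨⟨y, d₂⟩, hy⟩ := IsLocalization.surj R⁰ g.b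
  have hx₀ : x ≠ 0 := by
    rintro rfl
    simp only [map_zero, mul_eq_zero, Units.ne_zero, false_or] at hx
    exact nonZeroDivisors.ne_zero d₁.2
      (IsFractionRing.injective R (FractionRing R) (hx.trans (map_zero _).symm))
  refine ⟨d₁ * d₂, ⟨x, mem_nonZeroDivisors_of_ne_zero hx₀⟩ * d₂, y * d₁, ?_⟩
  rw [eq_inv_mul_iff_mul_eq, affineBy, AffineGroup.mul_def, AffineGroup.mul_def]
  ext
  · simp only [translationBy, dilationBy, Units.val_mul, IsUnit.unit_spec, Submonoid.coe_mul,
      map_mul, one_mul, ← hx]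
    ring
  · simp only [translationBy, dilationBy, IsUnit.unit_spec, Submonoid.coe_mul, map_mul, ← hy,
      Units.val_one, mul_zero, zero_add, add_zero]
    ring

section Lift

variable {S T} (hST : ∀ (m : R⁰) (n : R), S m * T (.ofAdd n) = T (.ofAdd (m * n)) * S m)

include hST in
theorem affineVal_congr {d c d' c' : R⁰} {r r' : R}
    (h : (dilationBy d)⁻¹ * affineBy c r = (dilationBy d')⁻¹ * affineBy c' r') :
    affineVal S T d c r = affineVal S T d' c' r' := by
  rw [← inv_mul_affineBy_mul_left d', ← inv_mul_affineBy_mul_left d d', mul_comm d' d,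
    mul_right_inj] at h
  obtain ⟨hc, hr⟩ := affineBy_inj h
  rw [← affineVal_mul_left hST d', ← affineVal_mul_left hST d d', mul_comm d' d, hc, hr]

include hST in
theorem exists_affineVal_eq (g : AffineGroup (FractionRing R)) :
    ∃ h, ∀ d c r, (dilationBy d)⁻¹ * affineBy c r = g → affineVal S T d c r = h := by
  obtain ⟨d, c, r, rfl⟩ := exists_eq_inv_mul_affineBy g
  exact ⟨_, fun _ _ _ => affineVal_congr hST⟩

/-- The homomorphism on the `ax + b`-group of the quotient field with prescribed values at the
integral dilations and translations. -/
def affineLift : AffineGroup (FractionRing R) →* H :=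
  let F : AffineGroup (FractionRing R) → H := fun g => (exists_affineVal_eq hST g).choose
  have hF : ∀ d c r, affineVal S T d c r = F ((dilationBy d)⁻¹ * affineBy c r) :=
    fun d c r => (exists_affineVal_eq hST _).choose_spec d c r rfl
  MonoidHom.mk' F fun g g' => by
    obtain ⟨d, c, r, rfl⟩ := exists_eq_inv_mul_affineBy g
    obtain ⟨d', c', r', rfl⟩ := exists_eq_inv_mul_affineBy g'
    have hmul : (dilationBy d)⁻¹ * affineBy c r * ((dilationBy d')⁻¹ * affineBy c' r') =
        (dilationBy (d' * d))⁻¹ * affineBy (c * c') (d' * r + c * r') := by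
      simp only [← affineVal_dilationHom_translationHom]
      exact affineVal_mul dilationBy_mul_translationBy d c d' c' r r'
    rw [hmul, ← hF, ← hF, ← hF, affineVal_mul hST]

theorem affineLift_inv_mul_affineBy (d c : R⁰) (r : R) :
    affineLift hST ((dilationBy d)⁻¹ * affineBy c r) = affineVal S T d c r :=
  ((exists_affineVal_eq hST _).choose_spec d c r rfl).symm

theorem affineLift_translationBy (n : R) : affineLift hST (translationBy n) = T (.ofAdd n) := by
  simpa only [affineVal, dilationBy_one, affineBy_one, map_one, inv_one, one_mul, mul_one] using
    affineLift_inv_mul_affineBy hST 1 1 n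

theorem affineLift_dilationBy (m : R⁰) : affineLift hST (dilationBy m) = S m := by
  simpa only [affineVal, dilationBy_one, affineBy_zero, map_one, inv_one, one_mul, ofAdd_zero]
    using affineLift_inv_mul_affineBy hST 1 m 0

end Lift

end AffineGroup

/-! ### Step functions on the finite adele space -/

section Adele

variable {R : Type*} [CommRing R]

namespace Hat

theorem comp_algebraMap (r : R) (m : R⁰) :
    (algebraMap R (Hat R) r).comp m = Ideal.Quotient.mk _ r := rfl

theorem comp_eq_of_dvd {m n : R⁰} (h : m ∣ n) {x y : Hat R} (hxy : x.comp n = y.comp n) :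
    x.comp m = y.comp m := by
  obtain ⟨l, rfl⟩ := h
  rw [mul_comm] at hxy
  rw [← comp_compat x l m, ← comp_compat y l m, hxy]

theorem comp_eq_mk_iff {y : Hat R} {m : R⁰} {n : R} :
    y.comp m = Ideal.Quotient.mk _ n ↔ ∃ z : Hat R, y = (m : R) • z + algebraMap R (Hat R) n := by
  have hsub : y.comp m = Ideal.Quotient.mk _ n ↔ (y - algebraMap R (Hat R) n).comp m = 0 :=
    sub_eq_zero.symm
  simp only [hsub, comp_eq_zero_iff, sub_eq_iff_eq_add]
  rfl

theorem isOpen_comp_eq (m : R⁰) (x : Hat R) : IsOpen {y : Hat R | y.comp m = x.comp m} := by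
  let _ : TopologicalSpace (R ⧸ Ideal.span {(m : R)}) := ⊥
  have : DiscreteTopology (R ⧸ Ideal.span {(m : R)}) := ⟨rfl⟩
  exact (isOpen_discrete {x.comp m}).preimage (continuous_comp m)

theorem exists_comp_eq_subset {U : Set (Hat R)} (hU : IsOpen U) {x : Hat R} (hx : x ∈ U) :
    ∃ m : R⁰, {y : Hat R | y.comp m = x.comp m} ⊆ U := by
  let _ : ∀ m : R⁰, TopologicalSpace (R ⧸ Ideal.span {(m : R)}) := fun _ => ⊥
  obtain ⟨V, hV, rfl⟩ := isOpen_induced_iff.1 hU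
  obtain ⟨I, u, hu, hI⟩ := isOpen_pi_iff.1 hV _ hx
  refine ⟨∏ i ∈ I, i, fun y hy => hI fun i hi => ?_⟩
  rw [comp_eq_of_dvd (Finset.dvd_prod_of_mem (fun i => i) hi) hy]
  exact (hu i hi).2

theorem exists_comp_eq_imp_dist_lt [CompactSpace (Hat R)] {X : Type*} [PseudoMetricSpace X]
    {f : Hat R → X} (hf : Continuous f) {ε : ℝ} (hε : 0 < ε) :
    ∃ m : R⁰, ∀ x y : Hat R, x.comp m = y.comp m → dist (f x) (f y) < ε := by
  have hloc : ∀ x : Hat R, ∃ m : R⁰, ∀ y : Hat R, y.comp m = x.comp m →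
      dist (f y) (f x) < ε / 2 := fun x =>
    exists_comp_eq_subset (Metric.isOpen_ball.preimage hf) (Metric.mem_ball_self (half_pos hε))
  choose m hm using hloc
  obtain ⟨t, ht⟩ := isCompact_univ.elim_finite_subcover
    (fun x : Hat R => {y : Hat R | y.comp (m x) = x.comp (m x)}) (fun x => isOpen_comp_eq _ x)
    fun x _ => Set.mem_iUnion.2 ⟨x, rfl⟩
  refine ⟨∏ x ∈ t, m x, fun x y hxy => ?_⟩
  obtain ⟨z, hz, hxz⟩ := Set.mem_iUnion₂.1 (ht (Set.mem_univ x))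
  have hxy_z := comp_eq_of_dvd (Finset.dvd_prod_of_mem m hz) hxy
  refine (dist_triangle_right _ _ (f z)).trans_lt ?_
  linarith [hm z x hxz, hm z y (hxy_z.symm.trans hxz)]

end Hat

namespace Adele

theorem exists_eq_ι (x : Adele R) : ∃ k y, x = ι k y :=
  LocalizedModule.induction_on (β := fun x => ∃ k y, x = ι k y) (fun y k => ⟨k, y, rfl⟩) x

theorem ι_smul (l k : R⁰) (y : Hat R) : ι (l * k) ((l : R) • y) = ι k y :=
  LocalizedModule.mk_cancel_common_left l k y

theorem ι_injective (k : R⁰) : Function.Injective (ι k : Hat R → Adele R) := by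
  intro x y h
  obtain ⟨u, hu⟩ := LocalizedModule.mk_eq.1 h
  exact Hat.smul_cancel k (Hat.smul_cancel u hu)

theorem algebraMap_smul_one (n : R) :
    algebraMap R (FractionRing R) n • (1 : Adele R) = Adele.ι 1 (algebraMap R (Hat R) n) := by
  have hone : (1 : Adele R) = LocalizedModule.mk 1 1 := OreLocalization.one_def
  change algebraMap R (Localization R⁰) n • _ = LocalizedModule.mk _ _
  rw [hone, ← Localization.mk_one_eq_algebraMap, Algebra.algebraMap_eq_smul_one]
  refine Eq.trans ?_ (congrArg (LocalizedModule.mk _) (one_mul (1 : R⁰)))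
  exact LocalizedModule.mk_smul_mk ..

section Finite

variable [∀ m : R⁰, Finite (R ⧸ Ideal.span {(m : R)})]

open Classical in
theorem pHat_apply (x : Adele R) : pHat R x = if x ∈ hat R then 1 else 0 := rfl

theorem isStarProjection_pHat : IsStarProjection (pHat R) where
  isIdempotentElem := by
    ext x
    change pHat R x * pHat R x = pHat R x
    rw [pHat_apply]
    split_ifs <;> simp
  isSelfAdjoint := by
    ext x
    change star (pHat R x) = pHat R x
    rw [pHat_apply]
    split_ifs <;> simp

theorem pHat_ne_zero : pHat R ≠ 0 := fun h => by
  have h0 : pHat R (ι 1 0) = 0 := congrArg (fun f : C₀(Adele R, ℂ) => f (ι 1 0)) h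
  rw [pHat_apply, if_pos ⟨0, rfl⟩] at h0
  exact one_ne_zero h0

end Finite

end Adele

variable [IsDomain R]

theorem dilationBy_smul_ι (m k : R⁰) (y : Hat R) :
    dilationBy m • Adele.ι k y = Adele.ι k ((m : R) • y) := by
  rw [Adele.smul_def]
  change algebraMap R (FractionRing R) m • Adele.ι k y + (0 : FractionRing R) • (1 : Adele R) = _
  rw [zero_smul, add_zero]
  change algebraMap R (Localization R⁰) m • LocalizedModule.mk y k = LocalizedModule.mk (_ • y) k
  rw [← Localization.mk_one_eq_algebraMap, LocalizedModule.mk_smul_mk, one_mul]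

theorem dilationBy_smul_ι_self (k : R⁰) (y : Hat R) :
    dilationBy k • Adele.ι k y = Adele.ι 1 y := by
  rw [dilationBy_smul_ι, ← Adele.ι_smul k 1 y, mul_one]

theorem translationBy_smul_ι_one (n : R) (y : Hat R) :
    translationBy n • Adele.ι 1 y = Adele.ι 1 (y + algebraMap R (Hat R) n) := by
  rw [Adele.smul_def]
  change ((1 : (FractionRing R)ˣ) : FractionRing R) • Adele.ι 1 y +
    algebraMap R (FractionRing R) n • (1 : Adele R) = _
  rw [Units.val_one, one_smul, Adele.algebraMap_smul_one]
  refine LocalizedModule.mk_add_mk.trans ?_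
  rw [one_smul, one_smul, one_mul]
  rfl

theorem affineBy_smul_ι_one (m : R⁰) (n : R) (y : Hat R) :
    affineBy m n • Adele.ι 1 y = Adele.ι 1 ((m : R) • y + algebraMap R (Hat R) n) := by
  rw [affineBy, mul_smul, dilationBy_smul_ι, translationBy_smul_ι_one]

theorem mem_hat_of_affineBy_inv_smul_mem_hat {m : R⁰} {n : R} {x : Adele R}
    (hx : (affineBy m n)⁻¹ • x ∈ Adele.hat R) : x ∈ Adele.hat R := by
  obtain ⟨y, hy⟩ := hx
  rw [eq_inv_smul_iff, affineBy_smul_ι_one] at hy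
  exact ⟨_, hy⟩

theorem affineBy_inv_smul_ι_one_mem_hat_iff {m : R⁰} {n : R} {y : Hat R} :
    (affineBy m n)⁻¹ • Adele.ι 1 y ∈ Adele.hat R ↔ y.comp m = Ideal.Quotient.mk _ n := by
  rw [Hat.comp_eq_mk_iff]
  refine exists_congr fun z => ?_
  rw [eq_inv_smul_iff, affineBy_smul_ι_one, (Adele.ι_injective 1).eq_iff, eq_comm]

namespace Adele

theorem mem_range_ι_iff {k : R⁰} {x : Adele R} :
    x ∈ Set.range (ι k) ↔ dilationBy k • x ∈ hat R := by
  refine exists_congr fun y => ?_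
  rw [← dilationBy_smul_ι_self k y, smul_left_cancel_iff]

theorem isOpen_range_ι (k : R⁰) : IsOpen (Set.range (ι k : Hat R → Adele R)) := by
  have hpre : Set.range (ι k : Hat R → Adele R) = (fun x => dilationBy k • x) ⁻¹' hat R :=
    Set.ext fun _ => mem_range_ι_iff
  rw [hpre]
  exact isClopen_hat.isOpen.preimage (continuous_const_smul _)

theorem exists_subset_range_ι {K : Set (Adele R)} (hK : IsCompact K) :
    ∃ k : R⁰, K ⊆ Set.range (ι k) := by
  refine hK.elim_directed_cover _ isOpen_range_ι (fun x _ => ?_) fun k l => ⟨l * k, ?_, ?_⟩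
  · obtain ⟨k, y, rfl⟩ := exists_eq_ι x
    exact Set.mem_iUnion.2 ⟨k, y, rfl⟩
  · rintro _ ⟨y, rfl⟩
    exact ⟨_, ι_smul l k y⟩
  · rintro _ ⟨y, rfl⟩
    rw [mul_comm]
    exact ⟨_, ι_smul k l y⟩

end Adele

variable (R) in
/-- The translation action on `C₀(𝓡)`. -/
abbrev act : AffineGroup (FractionRing R) →* (C₀(Adele R, ℂ) ≃⋆ₐ[ℂ] C₀(Adele R, ℂ)) :=
  translation (AffineGroup (FractionRing R)) (Adele R)

theorem act_apply (g : AffineGroup (FractionRing R)) (f : C₀(Adele R, ℂ)) (x : Adele R) :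
    act R g f x = f (g⁻¹ • x) := rfl

theorem act_mul_apply (g h : AffineGroup (FractionRing R)) (f : C₀(Adele R, ℂ)) :
    act R (g * h) f = act R g (act R h f) := by
  rw [map_mul, StarAlgEquiv.mul_apply]

variable [∀ m : R⁰, Finite (R ⧸ Ideal.span {(m : R)})]

open Adele

theorem pHat_mul_act_affineBy_pHat (m : R⁰) (n : R) :
    pHat R * act R (affineBy m n) (pHat R) = act R (affineBy m n) (pHat R) := by
  ext x
  change pHat R x * pHat R ((affineBy m n)⁻¹ • x) = pHat R ((affineBy m n)⁻¹ • x)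
  rw [pHat_apply, pHat_apply]
  by_cases h : (affineBy m n)⁻¹ • x ∈ hat R
  · rw [if_pos (mem_hat_of_affineBy_inv_smul_mem_hat h), one_mul]
  · rw [if_neg h, mul_zero]

open Classical in
theorem act_affineBy_pHat_ι_one (m : R⁰) (n : R) (y : Hat R) :
    act R (affineBy m n) (pHat R) (ι 1 y) = if y.comp m = Ideal.Quotient.mk _ n then 1 else 0 := by
  simp only [act_apply, pHat_apply, affineBy_inv_smul_ι_one_mem_hat_iff]

theorem act_affineBy_pHat_of_notMem_hat (m : R⁰) (n : R) {x : Adele R} (hx : x ∉ hat R) :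
    act R (affineBy m n) (pHat R) x = 0 := by
  rw [act_apply, pHat_apply, if_neg fun h => hx (mem_hat_of_affineBy_inv_smul_mem_hat h)]

theorem act_translationBy_pHat (n : R) : act R (translationBy n) (pHat R) = pHat R := by
  ext x
  rw [← affineBy_one]
  by_cases hx : x ∈ hat R
  · obtain ⟨y, rfl⟩ := hx
    have hcomp : y.comp 1 = Ideal.Quotient.mk _ n := by
      obtain ⟨r, hr⟩ := Ideal.Quotient.mk_surjective (y.comp 1)
      rw [← hr, Ideal.Quotient.eq, OneMemClass.coe_one, Ideal.span_singleton_one]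
      trivial
    rw [act_affineBy_pHat_ι_one, if_pos hcomp, pHat_apply, if_pos ⟨y, rfl⟩]
  · rw [act_affineBy_pHat_of_notMem_hat 1 n hx, pHat_apply, if_neg hx]

theorem zeroAtInfty_sum_apply {X ι E : Type*} [TopologicalSpace X] [NormedAddCommGroup E]
    (t : Finset ι) (f : ι → C₀(X, E)) (x : X) : (∑ i ∈ t, f i) x = ∑ i ∈ t, f i x :=
  map_sum (⟨⟨fun f => f x, rfl⟩, fun _ _ => rfl⟩ : C₀(X, E) →+ E) f t

section Sum

variable {m : R⁰} [Fintype (R ⧸ Ideal.span {(m : R)})]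

theorem sum_smul_act_affineBy_pHat_ι_one (c : R ⧸ Ideal.span {(m : R)} → ℂ) (y : Hat R) :
    (∑ q, c q • act R (affineBy m q.out) (pHat R)) (ι 1 y) = c (y.comp m) := by
  simp only [zeroAtInfty_sum_apply, ZeroAtInftyContinuousMap.smul_apply, act_affineBy_pHat_ι_one]
  rw [Finset.sum_eq_single (y.comp m)]
  · rw [if_pos (Ideal.Quotient.mk_out _).symm, smul_eq_mul, mul_one]
  · intro q _ hq
    rw [if_neg fun h => hq (h.trans (Ideal.Quotient.mk_out q)).symm, smul_zero]
  · simp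

theorem sum_smul_act_affineBy_pHat_of_notMem_hat (c : R ⧸ Ideal.span {(m : R)} → ℂ) {x : Adele R}
    (hx : x ∉ hat R) : (∑ q, c q • act R (affineBy m q.out) (pHat R)) x = 0 := by
  simp only [zeroAtInfty_sum_apply, ZeroAtInftyContinuousMap.smul_apply,
    act_affineBy_pHat_of_notMem_hat m _ hx, smul_zero, Finset.sum_const_zero]

variable (m) in
theorem sum_act_affineBy_pHat :
    ∑ q : R ⧸ Ideal.span {(m : R)}, act R (affineBy m q.out) (pHat R) = pHat R := by
  rw [← Finset.sum_congr rfl fun q _ => one_smul ℂ (act R (affineBy m q.out) (pHat R))]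
  ext x
  by_cases hx : x ∈ hat R
  · obtain ⟨y, rfl⟩ := hx
    rw [sum_smul_act_affineBy_pHat_ι_one fun _ => 1, pHat_apply, if_pos ⟨y, rfl⟩]
  · rw [sum_smul_act_affineBy_pHat_of_notMem_hat (fun _ => 1) hx, pHat_apply, if_neg hx]

end Sum

theorem exists_norm_sub_step_le (f : C₀(Adele R, ℂ)) {ε : ℝ} (hε : 0 < ε) :
    ∃ (k m : R⁰) (c : R ⧸ Ideal.span {(m : R)} → ℂ),
      ‖f - act R (dilationBy k)⁻¹ (∑ᶠ q, c q • act R (affineBy m q.out) (pHat R))‖ ≤ ε := by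
  obtain ⟨K, hK, hKε⟩ := Filter.mem_cocompact.1
    (f.zero_at_infty' (Metric.ball_mem_nhds (0 : ℂ) hε))
  obtain ⟨k, hk⟩ := exists_subset_range_ι hK
  obtain ⟨m, hm⟩ := Hat.exists_comp_eq_imp_dist_lt
    (f.continuous_toFun.comp (continuous_ι k)) hε
  have := Fintype.ofFinite (R ⧸ Ideal.span {(m : R)})
  refine ⟨k, m, fun q => f (ι k (algebraMap R (Hat R) q.out)), ?_⟩
  rw [finsum_eq_sum_of_fintype, ← ZeroAtInftyContinuousMap.norm_toBCF_eq_norm]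
  refine (BoundedContinuousFunction.norm_le hε.le).2 fun x => ?_
  change ‖f x - (∑ q : R ⧸ Ideal.span {(m : R)}, f (ι k (algebraMap R (Hat R) q.out)) •
    act R (affineBy m q.out) (pHat R)) ((dilationBy k)⁻¹⁻¹ • x)‖ ≤ ε
  rw [inv_inv]
  by_cases hx : x ∈ Set.range (ι k)
  · obtain ⟨y, rfl⟩ := hx
    rw [dilationBy_smul_ι_self, sum_smul_act_affineBy_pHat_ι_one, ← dist_eq_norm]
    exact (hm _ _ (by rw [Hat.comp_algebraMap, Ideal.Quotient.mk_out])).le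
  · rw [sum_smul_act_affineBy_pHat_of_notMem_hat _ (mem_range_ι_iff.not.1 hx), sub_zero]
    exact (mem_ball_zero_iff.1 (hKε fun hxK => hx (hk hxK))).le

theorem dense_span_act_pHat :
    Dense (Submodule.span ℂ (Set.range fun g => act R g (pHat R)) : Set C₀(Adele R, ℂ)) := by
  refine Metric.dense_iff.2 fun f ε hε => ?_
  obtain ⟨k, m, c, h⟩ := exists_norm_sub_step_le f (half_pos hε)
  have := Fintype.ofFinite (R ⧸ Ideal.span {(m : R)})
  refine ⟨act R (dilationBy k)⁻¹ (∑ᶠ q, c q • act R (affineBy m q.out) (pHat R)), ?_, ?_⟩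
  · rw [Metric.mem_ball, dist_comm, dist_eq_norm]
    exact h.trans_lt (half_lt_self hε)
  · rw [finsum_eq_sum_of_fintype, map_sum]
    refine Submodule.sum_mem _ fun q _ => ?_
    rw [map_smul, ← act_mul_apply]
    exact Submodule.smul_mem _ _ (Submodule.subset_span ⟨_, rfl⟩)

end Adele

/-! ### Orthogonal projections -/

section Projections

variable {C ι : Type*} [NonUnitalCStarAlgebra C] [Fintype ι] {p : ι → C}

theorem pairwise_mul_eq_zero (hp : ∀ i, IsStarProjection (p i))
    (he : IsStarProjection (∑ i, p i)) : Pairwise fun i j => p i * p j = 0 := by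
  classical
  let _ := CStarAlgebra.spectralOrder C
  have _ := CStarAlgebra.spectralOrderedRing C
  have h_nonneg (i : ι) : 0 ≤ p i := (hp i).nonneg
  have h_le (i : ι) : p i ≤ ∑ k, p k :=
    Finset.single_le_sum (fun k _ => h_nonneg k) (Finset.mem_univ i)
  intro i j hij
  have h_compl : IsStarProjection (∑ k, p k - p j) := ((hp j).le_iff_sub he).1 (h_le j)
  have h_le_compl : p i ≤ ∑ k, p k - p j := by
    rw [← Finset.sum_erase_eq_sub (Finset.mem_univ j)]
    exact Finset.single_le_sum (fun k _ => h_nonneg k)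
      (Finset.mem_erase.2 ⟨hij, Finset.mem_univ i⟩)
  have h_mul := ((hp i).le_iff_mul_eq_left h_compl).1 h_le_compl
  rwa [mul_sub, ((hp i).le_iff_mul_eq_left he).1 (h_le i), sub_eq_self] at h_mul

/-- The representation of `ℂ^ι` defined by a family of orthogonal projections. -/
def projHom (hp : ∀ i, IsStarProjection (p i)) (ho : Pairwise fun i j => p i * p j = 0) :
    (ι → ℂ) →⋆ₙₐ[ℂ] C where
  toFun c := ∑ i, c i • p i
  map_smul' a c := by
    simp only [Pi.smul_apply, smul_assoc, Finset.smul_sum, MonoidHom.id_apply]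
  map_zero' := by simp only [Pi.zero_apply, zero_smul, Finset.sum_const_zero]
  map_add' c d := by simp only [Pi.add_apply, add_smul, Finset.sum_add_distrib]
  map_mul' c d := by
    simp only [Finset.sum_mul_sum, smul_mul_smul_comm, Pi.mul_apply]
    refine Finset.sum_congr rfl fun i _ => ?_
    rw [Finset.sum_eq_single i (fun j _ hj => by rw [ho hj.symm, smul_zero]) (by simp),
      (hp i).isIdempotentElem.eq]
  map_star' c := by
    simp only [star_sum, star_smul, (hp _).isSelfAdjoint.star_eq, Pi.star_apply]

variable (hp : ∀ i, IsStarProjection (p i)) (ho : Pairwise fun i j => p i * p j = 0)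

theorem projHom_apply (c : ι → ℂ) : projHom hp ho c = ∑ i, c i • p i := rfl

theorem projHom_mul (c : ι → ℂ) (i : ι) : projHom hp ho c * p i = c i • p i := by
  simp only [projHom_apply, Finset.sum_mul, smul_mul_assoc]
  rw [Finset.sum_eq_single i (fun j _ hj => by rw [ho hj, smul_zero]) (by simp),
    (hp i).isIdempotentElem.eq]

theorem projHom_single [DecidableEq ι] (i : ι) : projHom hp ho (Pi.single i 1) = p i := by
  rw [projHom_apply, Finset.sum_eq_single i
    (fun j _ hj => by rw [Pi.single_eq_of_ne hj, zero_smul]) (by simp), Pi.single_eq_same, one_smul]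

theorem injective_comp_projHom {D : Type*} [NonUnitalCStarAlgebra D] (φ : C →⋆ₙₐ[ℂ] D)
    (hφ : ∀ i, φ (p i) ≠ 0) : Function.Injective (φ.comp (projHom hp ho)) :=
  (injective_iff_map_eq_zero _).2 fun c hc => funext fun i => by
    have h := congrArg φ (projHom_mul hp ho c i)
    rw [NonUnitalStarAlgHom.comp_apply] at hc
    rw [map_mul, hc, zero_mul, map_smul] at h
    exact (smul_eq_zero.1 h.symm).resolve_right (hφ i)

end Projections

/-! ### Homomorphisms given by their graphs -/

section Graph

variable {A B : Type*} [NonUnitalCStarAlgebra A] [NonUnitalCStarAlgebra B]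
  {S : NonUnitalStarSubalgebra ℂ (A × B)}

theorem norm_snd_le_of_mem_topologicalClosure (hb : ∀ x ∈ S, ‖x.2‖ ≤ ‖x.1‖) {x : A × B}
    (hx : x ∈ S.topologicalClosure) : ‖x.2‖ ≤ ‖x.1‖ :=
  closure_minimal (t := {x : A × B | ‖x.2‖ ≤ ‖x.1‖}) hb
    (isClosed_le (by fun_prop) (by fun_prop)) hx

variable (S) in
/-- The first projection of the closure of a ⋆-subalgebra of `A × B`. -/
def graphFst : S.topologicalClosure →⋆ₙₐ[ℂ] A :=
  (NonUnitalStarAlgHom.fst ℂ A B).comp (NonUnitalStarSubalgebraClass.subtype S.topologicalClosure)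

theorem isometry_graphFst (hb : ∀ x ∈ S, ‖x.2‖ ≤ ‖x.1‖) : Isometry (graphFst S) :=
  AddMonoidHomClass.isometry_of_norm _ fun x =>
    (max_eq_left (norm_snd_le_of_mem_topologicalClosure hb x.2)).symm

theorem bijective_graphFst (hb : ∀ x ∈ S, ‖x.2‖ ≤ ‖x.1‖)
    (hd : Dense (Prod.fst '' (S : Set (A × B)))) : Function.Bijective (graphFst S) := by
  refine ⟨(isometry_graphFst hb).injective, Set.range_eq_univ.1 ?_⟩
  have : CompleteSpace S.topologicalClosure :=
    S.isClosed_topologicalClosure.completeSpace_coe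
  have h_closed := (isometry_graphFst hb).isClosedEmbedding.isClosed_range
  rw [← h_closed.closure_eq]
  refine (hd.mono ?_).closure_eq
  rintro _ ⟨x, hx, rfl⟩
  exact ⟨⟨x, S.le_topologicalClosure hx⟩, rfl⟩

/-- The homomorphism whose graph is the closure of `S`. -/
def homOfGraph (hb : ∀ x ∈ S, ‖x.2‖ ≤ ‖x.1‖) (hd : Dense (Prod.fst '' (S : Set (A × B)))) :
    A →⋆ₙₐ[ℂ] B :=
  ((NonUnitalStarAlgHom.snd ℂ A B).comp
    (NonUnitalStarSubalgebraClass.subtype S.topologicalClosure)).comp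
      (StarAlgEquiv.ofBijective (graphFst S) (bijective_graphFst hb hd)).symm.toNonUnitalStarAlgHom

theorem homOfGraph_fst (hb : ∀ x ∈ S, ‖x.2‖ ≤ ‖x.1‖)
    (hd : Dense (Prod.fst '' (S : Set (A × B)))) {x : A × B} (hx : x ∈ S) :
    homOfGraph hb hd x.1 = x.2 := by
  have h : (StarAlgEquiv.ofBijective (graphFst S) (bijective_graphFst hb hd)).symm x.1 =
      ⟨x, S.le_topologicalClosure hx⟩ :=
    (StarAlgEquiv.symm_apply_eq _).2 rfl
  exact congrArg (fun y : S.topologicalClosure => y.1.2) h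

end Graph

/-! ### Covariant representations -/

section Covariant

variable {R : Type*} [CommRing R] [IsDomain R] {M : Type*} [CStarAlgebra M]

variable (R M) in
/-- A unitary representation of the `ax + b`-group and a projection `e` which is the sum of its
conjugates under `x ↦ m x + q`, for `q` in a set of representatives of `R/(m)`. These are the
relations between the group and `p_{R̂}` that determine a covariant representation of
`C₀(𝓡)`. -/
structure AffineRep where
  U : AffineGroup (FractionRing R) →* unitary M
  e : M
  isStarProjection_e : IsStarProjection e
  translation : ∀ n : R, Unitary.conjStarAlgAut ℂ M (U (translationBy n)) e = e
  sum_eq : ∀ m : R⁰, ∑ᶠ q : R ⧸ Ideal.span {(m : R)},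
    Unitary.conjStarAlgAut ℂ M (U (affineBy m q.out)) e = e

namespace AffineRep

variable (ρ : AffineRep R M)

/-- The action of the `ax + b`-group on `M` by inner automorphisms. -/
def conj : AffineGroup (FractionRing R) →* (M ≃⋆ₐ[ℂ] M) :=
  (Unitary.conjStarAlgAut ℂ M).comp ρ.U

theorem conj_apply (g : AffineGroup (FractionRing R)) (a : M) :
    ρ.conj g a = ρ.U g * a * star (ρ.U g : M) := rfl

/-- The diagonal action of the `ax + b`-group on `C₀(𝓡) × M`. -/
def pairAct (g : AffineGroup (FractionRing R)) :
    C₀(Adele R, ℂ) × M →⋆ₙₐ[ℂ] C₀(Adele R, ℂ) × M :=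
  ((act R g).toNonUnitalStarAlgHom.comp (NonUnitalStarAlgHom.fst ℂ _ _)).prod
    ((ρ.conj g).toNonUnitalStarAlgHom.comp (NonUnitalStarAlgHom.snd ℂ _ _))

variable [∀ m : R⁰, Finite (R ⧸ Ideal.span {(m : R)})]

/-- The translates of `(p_{R̂}, e)`. They span the graph of the representation of `C₀(𝓡)` that
extends `ρ`. -/
def pair (g : AffineGroup (FractionRing R)) : C₀(Adele R, ℂ) × M :=
  ρ.pairAct g (Adele.pHat R, ρ.e)

theorem pair_mul (g h : AffineGroup (FractionRing R)) :
    ρ.pair (g * h) = ρ.pairAct g (ρ.pair h) := by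
  refine Prod.ext (act_mul_apply g h _) ?_
  change ρ.conj (g * h) ρ.e = ρ.conj g (ρ.conj h ρ.e)
  rw [map_mul, StarAlgEquiv.mul_apply]

theorem pair_fst_ne_zero (g : AffineGroup (FractionRing R)) : (ρ.pair g).1 ≠ 0 :=
  (map_ne_zero_iff (act R g) (act R g).injective).2 Adele.pHat_ne_zero

theorem isStarProjection_pair (g : AffineGroup (FractionRing R)) :
    IsStarProjection (ρ.pair g) := by
  refine IsStarProjection.map ⟨?_, ?_⟩ (ρ.pairAct g)
  · exact Prod.ext Adele.isStarProjection_pHat.isIdempotentElem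
      ρ.isStarProjection_e.isIdempotentElem
  · exact Prod.ext Adele.isStarProjection_pHat.isSelfAdjoint ρ.isStarProjection_e.isSelfAdjoint

theorem pair_mul_translationBy (g : AffineGroup (FractionRing R)) (n : R) :
    ρ.pair (g * translationBy n) = ρ.pair g := by
  rw [pair_mul, pair]
  exact congrArg _ (Prod.ext (act_translationBy_pHat n) (ρ.translation n))

instance fintypeQuotient (m : R⁰) : Fintype (R ⧸ Ideal.span {(m : R)}) := Fintype.ofFinite _

theorem sum_pair (g : AffineGroup (FractionRing R)) (m : R⁰) :
    ∑ q : R ⧸ Ideal.span {(m : R)}, ρ.pair (g * affineBy m q.out) = ρ.pair g := by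
  simp only [pair_mul]
  rw [← map_sum, pair]
  refine congrArg _ (Prod.ext ?_ ?_)
  · rw [Prod.fst_sum]
    exact sum_act_affineBy_pHat m
  · rw [Prod.snd_sum]
    exact (finsum_eq_sum_of_fintype _).symm.trans (ρ.sum_eq m)

theorem pair_affineBy_out (g : AffineGroup (FractionRing R)) (m : R⁰) (n : R) :
    ρ.pair (g * affineBy m (Ideal.Quotient.mk (Ideal.span {(m : R)}) n).out) =
      ρ.pair (g * affineBy m n) := by
  have h := Ideal.Quotient.mk_out (Ideal.Quotient.mk (Ideal.span {(m : R)}) n)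
  rw [Ideal.Quotient.eq, Ideal.mem_span_singleton] at h
  obtain ⟨t, ht⟩ := h
  rw [← ρ.pair_mul_translationBy (g * affineBy m n) t, mul_assoc, ← affineBy_one, affineBy_mul,
    mul_one, ← ht, add_sub_cancel]

theorem pairwise_pair_mul_eq_zero (g : AffineGroup (FractionRing R)) (m : R⁰) :
    Pairwise fun q q' : R ⧸ Ideal.span {(m : R)} =>
      ρ.pair (g * affineBy m q.out) * ρ.pair (g * affineBy m q'.out) = 0 := by
  refine pairwise_mul_eq_zero (fun _ => ρ.isStarProjection_pair _) ?_
  rw [ρ.sum_pair g m]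
  exact ρ.isStarProjection_pair g

/-- The step functions of level `(k, m)`, paired with their images. -/
def stepHom (k m : R⁰) : (R ⧸ Ideal.span {(m : R)} → ℂ) →⋆ₙₐ[ℂ] C₀(Adele R, ℂ) × M :=
  projHom (fun _ => ρ.isStarProjection_pair _) (ρ.pairwise_pair_mul_eq_zero (dilationBy k)⁻¹ m)

theorem pair_mem_range_stepHom (k m : R⁰) (n : R) :
    ρ.pair ((dilationBy k)⁻¹ * affineBy m n) ∈ NonUnitalStarAlgHom.range (ρ.stepHom k m) := by
  classical
  rw [← ρ.pair_affineBy_out]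
  exact ⟨Pi.single (Ideal.Quotient.mk _ n) 1, projHom_single (fun _ => ρ.isStarProjection_pair _)
    (ρ.pairwise_pair_mul_eq_zero (dilationBy k)⁻¹ m) _⟩

theorem range_stepHom_le {k m : R⁰} {S : NonUnitalStarSubalgebra ℂ (C₀(Adele R, ℂ) × M)}
    (h : ∀ n, ρ.pair ((dilationBy k)⁻¹ * affineBy m n) ∈ S) :
    NonUnitalStarAlgHom.range (ρ.stepHom k m) ≤ S := by
  rintro _ ⟨c, rfl⟩
  exact sum_mem fun q _ => SMulMemClass.smul_mem _ (h _)

theorem range_stepHom_le_mul_mul (l k m : R⁰) : NonUnitalStarAlgHom.range (ρ.stepHom k m) ≤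
    NonUnitalStarAlgHom.range (ρ.stepHom (l * k) (l * m)) :=
  ρ.range_stepHom_le fun n => by
    rw [← inv_mul_affineBy_mul_left l]
    exact ρ.pair_mem_range_stepHom _ _ _

theorem range_stepHom_le_mul_right (l k m : R⁰) : NonUnitalStarAlgHom.range (ρ.stepHom k m) ≤
    NonUnitalStarAlgHom.range (ρ.stepHom k (m * l)) :=
  ρ.range_stepHom_le fun n => by
    rw [← ρ.sum_pair _ l]
    refine sum_mem fun q _ => ?_
    rw [mul_assoc, affineBy_mul]
    exact ρ.pair_mem_range_stepHom _ _ _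

theorem directed_range_stepHom : Directed (· ≤ ·) fun i : R⁰ × R⁰ =>
    NonUnitalStarAlgHom.range (ρ.stepHom i.1 i.2) := by
  rintro ⟨k, m⟩ ⟨k', m'⟩
  refine ⟨(k * k', k' * m * (k * m')), ?_, ?_⟩
  · have h := (ρ.range_stepHom_le_mul_mul k' k m).trans
      (ρ.range_stepHom_le_mul_right (k * m') _ _)
    rwa [mul_comm k' k] at h
  · have h := (ρ.range_stepHom_le_mul_mul k k' m').trans
      (ρ.range_stepHom_le_mul_right (k' * m) _ _)
    rwa [mul_comm (k * m')] at h

/-- The algebra of step functions, paired with their images. -/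
def stepGraph : NonUnitalStarSubalgebra ℂ (C₀(Adele R, ℂ) × M) :=
  ⨆ i : R⁰ × R⁰, NonUnitalStarAlgHom.range (ρ.stepHom i.1 i.2)

theorem mem_stepGraph {x : C₀(Adele R, ℂ) × M} :
    x ∈ ρ.stepGraph ↔ ∃ k m c, ρ.stepHom k m c = x := by
  rw [← SetLike.mem_coe, stepGraph,
    NonUnitalStarSubalgebra.coe_iSup_of_directed ρ.directed_range_stepHom, Set.mem_iUnion,
    Prod.exists]
  rfl

theorem pair_mem_stepGraph (g : AffineGroup (FractionRing R)) : ρ.pair g ∈ ρ.stepGraph := by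
  obtain ⟨d, c, r, rfl⟩ := exists_eq_inv_mul_affineBy g
  obtain ⟨x, hx⟩ := ρ.pair_mem_range_stepHom d c r
  exact ρ.mem_stepGraph.2 ⟨d, c, x, hx⟩

theorem dense_fst_stepGraph :
    Dense (Prod.fst '' (ρ.stepGraph : Set (C₀(Adele R, ℂ) × M))) := by
  have h_span : Submodule.span ℂ (Set.range fun g => act R g (Adele.pHat R)) ≤
      ρ.stepGraph.toSubmodule.map (LinearMap.fst ℂ C₀(Adele R, ℂ) M) :=
    Submodule.span_le.2 <| Set.range_subset_iff.2 fun g =>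
      ⟨ρ.pair g, ρ.pair_mem_stepGraph g, rfl⟩
  exact dense_span_act_pHat.mono h_span

theorem norm_stepHom_fst (k m : R⁰) (c : R ⧸ Ideal.span {(m : R)} → ℂ) :
    ‖(ρ.stepHom k m c).1‖ = ‖c‖ :=
  NonUnitalStarAlgHom.norm_map ((NonUnitalStarAlgHom.fst ℂ _ _).comp (ρ.stepHom k m))
    (injective_comp_projHom _ _ _ fun _ => ρ.pair_fst_ne_zero _) c

theorem norm_snd_le_of_mem_stepGraph : ∀ x ∈ ρ.stepGraph, ‖x.2‖ ≤ ‖x.1‖ := by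
  intro x hx
  obtain ⟨k, m, c, rfl⟩ := ρ.mem_stepGraph.1 hx
  rw [norm_stepHom_fst]
  exact NonUnitalStarAlgHom.norm_apply_le
    ((NonUnitalStarAlgHom.snd ℂ _ _).comp (ρ.stepHom k m)) c

/-- The representation of `C₀(𝓡)` which maps the translates of `p_{R̂}` to those of `e`. -/
def rep : C₀(Adele R, ℂ) →⋆ₙₐ[ℂ] M :=
  homOfGraph ρ.norm_snd_le_of_mem_stepGraph ρ.dense_fst_stepGraph

theorem rep_act_pHat (g : AffineGroup (FractionRing R)) :
    ρ.rep (act R g (Adele.pHat R)) = ρ.conj g ρ.e :=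
  homOfGraph_fst _ _ (ρ.pair_mem_stepGraph g)

theorem rep_pHat : ρ.rep (Adele.pHat R) = ρ.e := by
  simpa only [map_one, StarAlgEquiv.one_apply] using ρ.rep_act_pHat 1

theorem rep_act (g : AffineGroup (FractionRing R)) (f : C₀(Adele R, ℂ)) :
    ρ.rep (act R g f) = ρ.conj g (ρ.rep f) := by
  let φ := ρ.rep.comp (act R g).toNonUnitalStarAlgHom
  let ψ := (ρ.conj g).toNonUnitalStarAlgHom.comp ρ.rep
  have h_span : Set.EqOn φ ψ
      (Submodule.span ℂ (Set.range fun h => act R h (Adele.pHat R))) := by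
    refine LinearMap.eqOn_span (f := (φ : C₀(Adele R, ℂ) →ₗ[ℂ] M))
      (g := (ψ : C₀(Adele R, ℂ) →ₗ[ℂ] M)) ?_
    rintro _ ⟨h, rfl⟩
    change ρ.rep (act R g (act R h (Adele.pHat R))) = ρ.conj g (ρ.rep (act R h (Adele.pHat R)))
    rw [← act_mul_apply, rep_act_pHat, rep_act_pHat, map_mul, StarAlgEquiv.mul_apply]
  exact congrFun (Continuous.ext_on dense_span_act_pHat (map_continuous φ) (map_continuous ψ)
    h_span) f

theorem covariant (g : AffineGroup (FractionRing R)) (f : C₀(Adele R, ℂ)) :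
    (ρ.U g : M) * ρ.rep f = ρ.rep (act R g f) * ρ.U g := by
  rw [rep_act, conj_apply, mul_assoc, Unitary.coe_star_mul_self, mul_one]

/-- The representation of the crossed product. -/
def integrated : AdelicCrossedProduct R →⋆ₙₐ[ℂ] M :=
  CrossedProduct.lift ρ.rep ρ.U ρ.covariant

theorem integrated_Vp (g : AffineGroup (FractionRing R)) : ρ.integrated (Vp g) = ρ.U g * ρ.e := by
  rw [integrated, Vp, CrossedProduct.lift_V, rep_pHat]

end AffineRep

end Covariant

/-! ### The isomorphisms -/

section Main

open DoubleCentralizer (coeHom)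
open scoped MultiplierAlgebra

variable {R : Type*} [CommRing R]

theorem isStarProjection_coeHom_of_one :
    IsStarProjection (coeHom (StableAlg.of 1 1) : 𝓜(ℂ, StableAlg R)) :=
  (RingAlg.isStarProjection_one.map (StableAlg.of 1)).map coeHom

variable [IsDomain R]

variable (R) in
/-- The unitary representation of the `ax + b`-group in the multiplier algebra of `𝔄(R)`. -/
def multiplierHom : AffineGroup (FractionRing R) →* unitary 𝓜(ℂ, StableAlg R) :=
  affineLift StableAlg.dilHom_mul_transHom

theorem multiplierHom_dilationBy (m : R⁰) :
    (multiplierHom R (dilationBy m) : 𝓜(ℂ, StableAlg R)) = StableAlg.dil m :=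
  congrArg Subtype.val (affineLift_dilationBy StableAlg.dilHom_mul_transHom m)

theorem multiplierHom_translationBy (n : R) :
    (multiplierHom R (translationBy n) : 𝓜(ℂ, StableAlg R)) = StableAlg.trans n :=
  congrArg Subtype.val (affineLift_translationBy StableAlg.dilHom_mul_transHom n)

theorem multiplierHom_affineBy_mul (m : R⁰) (n : R) :
    (multiplierHom R (affineBy m n) : 𝓜(ℂ, StableAlg R)) * coeHom (StableAlg.of 1 1) =
      coeHom (StableAlg.of 1 (.u n * .s m)) := by
  rw [affineBy, map_mul, Submonoid.coe_mul, multiplierHom_dilationBy, multiplierHom_translationBy,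
    mul_assoc, multiplier_mul_coe, StableAlg.dil_fst, multiplier_mul_coe, StableAlg.trans_fst,
    RingAlg.mul_one', OneMemClass.coe_one, one_mul]

theorem conj_multiplierHom_affineBy (m : R⁰) (n : R) :
    Unitary.conjStarAlgAut ℂ _ (multiplierHom R (affineBy m n)) (coeHom (StableAlg.of 1 1)) =
      coeHom (StableAlg.of 1 (.u n * (.s m * star (.s m)) * star (.u n))) := by
  let V : 𝓜(ℂ, StableAlg R) := multiplierHom R (affineBy m n)
  let e : 𝓜(ℂ, StableAlg R) := coeHom (StableAlg.of 1 1)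
  have he : IsStarProjection e := isStarProjection_coeHom_of_one
  have hV : V * e = coeHom (StableAlg.of 1 (.u n * .s m)) := multiplierHom_affineBy_mul m n
  calc V * e * star V
    _ = V * e * star (V * e) := by
        rw [star_mul, he.isSelfAdjoint.star_eq, ← mul_assoc, mul_assoc V e e,
          he.isIdempotentElem.eq]
    _ = _ := by
        rw [hV, ← map_star, ← map_star, ← map_mul, ← map_mul, star_mul]
        simp only [mul_assoc]

variable [∀ m : R⁰, Finite (R ⧸ Ideal.span {(m : R)})]

theorem isStarProjection_projHat : IsStarProjection (projHat R) :=
  Adele.isStarProjection_pHat.map (CrossedProduct.inclusion (act R))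

variable (R) in
theorem Vp_one : (Vp 1 : AdelicCrossedProduct R) = projHat R := CrossedProduct.V_one _

theorem Vp_mul_Vp_affineBy (g : AffineGroup (FractionRing R)) (m : R⁰) (n : R) :
    Vp g * Vp (affineBy m n) = Vp (g * affineBy m n) := by
  have h := congrArg (act R (affineBy m n)⁻¹) (pHat_mul_act_affineBy_pHat m n)
  rw [map_mul, ← act_mul_apply, inv_mul_cancel, map_one, StarAlgEquiv.one_apply] at h
  rw [Vp, Vp, CrossedProduct.V_mul_V, h, Vp]

theorem star_Vp (g : AffineGroup (FractionRing R)) :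
    star (Vp g) = CrossedProduct.V (act R) g⁻¹ (act R g (Adele.pHat R)) := by
  rw [Vp, CrossedProduct.star_V, Adele.isStarProjection_pHat.isSelfAdjoint.star_eq]

theorem star_Vp_mul_Vp (g : AffineGroup (FractionRing R)) : star (Vp g) * Vp g = projHat R := by
  rw [Vp, CrossedProduct.star_V_mul_V, Adele.isStarProjection_pHat.isSelfAdjoint.star_eq,
    Adele.isStarProjection_pHat.isIdempotentElem.eq, projHat]

theorem Vp_mul_star_Vp (g h : AffineGroup (FractionRing R)) :
    Vp g * star (Vp h) = CrossedProduct.V (act R) (g * h⁻¹) (act R h (Adele.pHat R)) := by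
  rw [star_Vp, Vp, CrossedProduct.V_mul_V, inv_inv, ← map_mul,
    Adele.isStarProjection_pHat.isIdempotentElem.eq]

theorem Vp_mul_star_Vp_self (g : AffineGroup (FractionRing R)) :
    Vp g * star (Vp g) = CrossedProduct.inclusion (act R) (act R g (Adele.pHat R)) := by
  rw [Vp_mul_star_Vp, mul_inv_cancel, CrossedProduct.V_one]

theorem Vp_mul_projHat (g : AffineGroup (FractionRing R)) : Vp g * projHat R = Vp g := by
  simpa only [affineBy_zero, dilationBy_one, Vp_one, mul_one] using
    Vp_mul_Vp_affineBy g 1 (0 : R)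

theorem projHat_mul_Vp_affineBy (m : R⁰) (n : R) :
    projHat R * Vp (affineBy m n) = Vp (affineBy m n) := by
  rw [← Vp_one, Vp_mul_Vp_affineBy, one_mul]

theorem star_Vp_translationBy (n : R) :
    star (Vp (translationBy n)) = Vp (translationBy (-n)) := by
  rw [star_Vp, act_translationBy_pHat, translationBy_neg, Vp]

variable (R) in
/-- The elements `V_g p_{R̂}` for integral dilations and translations satisfy the relations of
`𝔄[R]`. -/
def adelicRep : RingRep R (AdelicCrossedProduct R) where
  e := projHat R
  s m := Vp (dilationBy m)
  u n := Vp (translationBy n)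
  isStarProjection_e := isStarProjection_projHat
  e_mul_s m := by rw [← affineBy_zero, projHat_mul_Vp_affineBy]
  s_mul_e m := Vp_mul_projHat _
  e_mul_u n := by rw [← affineBy_one, projHat_mul_Vp_affineBy]
  u_mul_e n := Vp_mul_projHat _
  star_s_mul_s m := star_Vp_mul_Vp _
  star_u_mul_u n := star_Vp_mul_Vp _
  u_mul_star_u n := by rw [Vp_mul_star_Vp_self, act_translationBy_pHat, projHat]
  s_mul_s k m := by rw [← affineBy_zero m, Vp_mul_Vp_affineBy, affineBy_zero, dilationBy_mul]
  u_mul_u l n := by rw [← affineBy_one n, Vp_mul_Vp_affineBy, affineBy_one, translationBy_add]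
  s_mul_u m n := by
    rw [← affineBy_one n, Vp_mul_Vp_affineBy, affineBy_one, dilationBy_mul_translationBy,
      ← affineBy_zero m, Vp_mul_Vp_affineBy]
  sum_eq m := by
    have hterm (q : R ⧸ Ideal.span {(m : R)}) :
        Vp (translationBy q.out) * (Vp (dilationBy m) * star (Vp (dilationBy m))) *
          Vp (translationBy (-q.out)) =
            CrossedProduct.inclusion (act R) (act R (affineBy m q.out) (Adele.pHat R)) := by
      rw [← star_Vp_translationBy, ← mul_assoc, mul_assoc, ← star_mul, ← affineBy_zero,
        Vp_mul_Vp_affineBy, affineBy_zero, ← affineBy, Vp_mul_star_Vp_self]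
    rw [finsum_eq_sum_of_fintype, Finset.sum_congr rfl fun q _ => hterm q, ← map_sum,
      sum_act_affineBy_pHat, projHat]

variable (R) in
/-- The map from `𝔄[R]` to the crossed product, with image in the corner of `p_{R̂}`. -/
def toCrossed : RingAlg R →⋆ₙₐ[ℂ] AdelicCrossedProduct R := (adelicRep R).lift

theorem toCrossed_s (m : R⁰) : toCrossed R (.s m) = Vp (dilationBy m) :=
  (adelicRep R).lift_s m

theorem toCrossed_u (n : R) : toCrossed R (.u n) = Vp (translationBy n) :=
  (adelicRep R).lift_u n

theorem toCrossed_one : toCrossed R 1 = projHat R := (adelicRep R).lift_one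

theorem toCrossed_u_mul_s (n : R) (m : R⁰) : toCrossed R (.u n * .s m) = Vp (affineBy m n) := by
  rw [map_mul, toCrossed_u, toCrossed_s, ← affineBy_zero, Vp_mul_Vp_affineBy, affineBy_zero,
    affineBy]

theorem projHat_mul_toCrossed (x : RingAlg R) : projHat R * toCrossed R x = toCrossed R x := by
  rw [← toCrossed_one, ← map_mul, RingAlg.one_mul']

theorem toCrossed_mul_projHat (x : RingAlg R) : toCrossed R x * projHat R = toCrossed R x := by
  rw [← toCrossed_one, ← map_mul, RingAlg.mul_one']

/-- The map `x ↦ V_k⋆ β(x) V_k`, which is to be the restriction of `Φ` to `𝔄(R)_k`. -/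
def toCrossedAt (k : R⁰) : RingAlg R →⋆ₙₐ[ℂ] AdelicCrossedProduct R where
  toFun x := Vp (dilationBy k)⁻¹ * toCrossed R x * star (Vp (dilationBy k)⁻¹)
  map_smul' c x := by rw [map_smul, mul_smul_comm, smul_mul_assoc]; rfl
  map_zero' := by rw [map_zero, mul_zero, zero_mul]
  map_add' x y := by rw [map_add, mul_add, add_mul]
  map_mul' x y := by
    simp only [mul_assoc]
    rw [← mul_assoc (star (Vp (dilationBy k)⁻¹)) (Vp (dilationBy k)⁻¹), star_Vp_mul_Vp,
      ← mul_assoc (projHat R), projHat_mul_toCrossed, map_mul, mul_assoc]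
  map_star' x := by rw [star_mul, star_mul, star_star, map_star, mul_assoc]

theorem toCrossedAt_apply (k : R⁰) (x : RingAlg R) :
    toCrossedAt k x = Vp (dilationBy k)⁻¹ * toCrossed R x * star (Vp (dilationBy k)⁻¹) := rfl

theorem toCrossedAt_conj (k l : R⁰) (x : RingAlg R) :
    toCrossedAt (l * k) (RingAlg.conj l x) = toCrossedAt k x := by
  have h : Vp (dilationBy (l * k))⁻¹ * Vp (dilationBy l) = Vp (dilationBy k)⁻¹ := by
    rw [← affineBy_zero l, Vp_mul_Vp_affineBy, affineBy_zero, dilationBy_mul, mul_inv_rev,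
      inv_mul_cancel_right]
  rw [toCrossedAt_apply, toCrossedAt_apply, ← h, star_mul]
  change _ * toCrossed R (.s l * x * star (.s l)) * _ = _
  rw [map_mul, map_mul, map_star, toCrossed_s]
  simp only [mul_assoc]

variable (R) in
/-- The map from `𝔄(R)` to the crossed product. -/
def stableToCrossed : StableAlg R →⋆ₙₐ[ℂ] AdelicCrossedProduct R :=
  StableAlg.lift toCrossedAt toCrossedAt_conj

theorem stableToCrossed_of (k : R⁰) (x : RingAlg R) :
    stableToCrossed R (StableAlg.of k x) =
      Vp (dilationBy k)⁻¹ * toCrossed R x * star (Vp (dilationBy k)⁻¹) :=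
  StableAlg.lift_of _ _ k x

theorem stableToCrossed_of_one (x : RingAlg R) :
    stableToCrossed R (StableAlg.of 1 x) = toCrossed R x := by
  rw [stableToCrossed_of, dilationBy_one, inv_one, Vp_one, (isSelfAdjoint_projHat R).star_eq,
    projHat_mul_toCrossed, toCrossed_mul_projHat]

variable (R) in
/-- The covariant representation in the multiplier algebra of `𝔄(R)`: its integrated form inverts
`stableToCrossed`. -/
def multiplierRep : AffineRep R 𝓜(ℂ, StableAlg R) where
  U := multiplierHom R
  e := coeHom (StableAlg.of 1 1)
  isStarProjection_e := isStarProjection_coeHom_of_one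
  translation n := by
    rw [← affineBy_one, conj_multiplierHom_affineBy, RingAlg.s_one,
      RingAlg.isStarProjection_one.isSelfAdjoint.star_eq, RingAlg.one_mul', RingAlg.mul_one',
      RingAlg.u_mul_star_u]
  sum_eq m := by
    rw [finsum_eq_sum_of_fintype]
    simp only [conj_multiplierHom_affineBy]
    rw [← map_sum, ← map_sum, RingAlg.sum_eq_one]

theorem integrated_toCrossed (x : RingAlg R) :
    (multiplierRep R).integrated (toCrossed R x) = coeHom (StableAlg.of 1 x) := by
  have haffine (m : R⁰) (n : R) : (multiplierRep R).integrated (toCrossed R (.u n * .s m)) =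
      coeHom (StableAlg.of 1 (.u n * .s m)) := by
    rw [toCrossed_u_mul_s, AffineRep.integrated_Vp]
    exact multiplierHom_affineBy_mul m n
  have h : (multiplierRep R).integrated.comp (toCrossed R) =
      (coeHom (𝕜 := ℂ)).comp (StableAlg.of 1) := by
    refine RingAlg.hom_ext (fun m => ?_) fun n => ?_
    · have hm := haffine m 0
      rwa [RingAlg.u_zero, RingAlg.one_mul'] at hm
    · have hn := haffine 1 n
      rwa [RingAlg.s_one, RingAlg.mul_one'] at hn
  exact DFunLike.congr_fun h x

theorem integrated_Vp_inv_dilationBy (k : R⁰) :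
    (multiplierRep R).integrated (Vp (dilationBy k)⁻¹) =
      star (StableAlg.dil k) * coeHom (StableAlg.of 1 1) := by
  have h : ((multiplierHom R (dilationBy k)⁻¹ : unitary _) : 𝓜(ℂ, StableAlg R)) =
      star (StableAlg.dil k) := by
    rw [map_inv, ← multiplierHom_dilationBy]; rfl
  rw [AffineRep.integrated_Vp, ← h]
  rfl

theorem integrated_stableToCrossed (x : StableAlg R) :
    (multiplierRep R).integrated (stableToCrossed R x) = coeHom x := by
  refine StableAlg.denseRange_of.induction_on x (isClosed_eq ((map_continuous _).comp
    (map_continuous _)) (map_continuous _)) fun ⟨k, y⟩ => ?_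
  let e : 𝓜(ℂ, StableAlg R) := coeHom (StableAlg.of 1 1)
  let z : 𝓜(ℂ, StableAlg R) := coeHom (StableAlg.of 1 y)
  have hcorner : e * z * e = z := by
    simp only [e, z, ← map_mul, RingAlg.one_mul', RingAlg.mul_one']
  have he : star e = e := isStarProjection_coeHom_of_one.isSelfAdjoint.star_eq
  rw [stableToCrossed_of, map_mul, map_mul, map_star, integrated_toCrossed,
    integrated_Vp_inv_dilationBy]
  calc star (StableAlg.dil k) * e * z * star (star (StableAlg.dil k) * e)
    _ = star (StableAlg.dil k) * (e * z * e) * StableAlg.dil k := by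
        rw [star_mul, star_star, he]
        simp only [mul_assoc]
    _ = coeHom (StableAlg.of k y) := by
        rw [hcorner, StableAlg.star_dil_mul_of_one_mul_dil]

variable (R) in
theorem injective_stableToCrossed : Function.Injective (stableToCrossed R) := fun x y h =>
  coeHom_injective (by rw [← integrated_stableToCrossed, h, integrated_stableToCrossed])

variable (R) in
theorem isClosed_range_stableToCrossed : IsClosed (Set.range (stableToCrossed R)) :=
  (NonUnitalStarAlgHom.isometry _ (injective_stableToCrossed R)).isClosedEmbedding.isClosed_range

theorem Vp_mul_star_Vp_mem_range (k c c' : R⁰) (r r' : R) :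
    Vp ((dilationBy k)⁻¹ * affineBy c r) * star (Vp ((dilationBy k)⁻¹ * affineBy c' r')) ∈
      Set.range (stableToCrossed R) := by
  refine ⟨StableAlg.of k (.u r * .s c * star (.u r' * .s c')), ?_⟩
  rw [stableToCrossed_of, map_mul, map_star, toCrossed_u_mul_s, toCrossed_u_mul_s,
    ← Vp_mul_Vp_affineBy, ← Vp_mul_Vp_affineBy, star_mul]
  simp only [mul_assoc]

theorem V_act_pHat_mem_range (g h : AffineGroup (FractionRing R)) :
    CrossedProduct.V (act R) g (act R h (Adele.pHat R)) ∈ Set.range (stableToCrossed R) := by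
  have hV : CrossedProduct.V (act R) g (act R h (Adele.pHat R)) = Vp (g * h) * star (Vp h) := by
    rw [Vp_mul_star_Vp, mul_inv_cancel_right]
  obtain ⟨d, c, r, hd⟩ := exists_eq_inv_mul_affineBy (g * h)
  obtain ⟨d', c', r', hd'⟩ := exists_eq_inv_mul_affineBy h
  rw [hV, hd, hd', ← inv_mul_affineBy_mul_left d', ← inv_mul_affineBy_mul_left d d',
    mul_comm d' d]
  exact Vp_mul_star_Vp_mem_range _ _ _ _ _

variable (R) in
theorem surjective_stableToCrossed : Function.Surjective (stableToCrossed R) := by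
  have htop : LinearMap.range (stableToCrossed R : StableAlg R →ₗ[ℂ] AdelicCrossedProduct R) = ⊤ :=
    CrossedProduct.eq_top_of_V_mem_of_dense_span dense_span_act_pHat
      (isClosed_range_stableToCrossed R)
      fun g => Set.forall_mem_range.2 (V_act_pHat_mem_range g)
  exact LinearMap.range_eq_top.1 htop

variable (R) in
/-- The map from `𝔄[R]` to the corner of the crossed product. -/
def toCorner : RingAlg R →⋆ₙₐ[ℂ] AdelicCorner R :=
  NonUnitalStarAlgHom.codRestrict (toCrossed R) (AdelicCorner R) fun x =>
    mem_corner _ (projHat_mul_toCrossed x) (toCrossed_mul_projHat x)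

variable (R) in
theorem injective_toCorner : Function.Injective (toCorner R) := fun x y h => by
  have hxy : toCrossed R x = toCrossed R y := congrArg Subtype.val h
  rw [← stableToCrossed_of_one, ← stableToCrossed_of_one] at hxy
  exact (AddMonoidHomClass.isometry_of_norm _ (StableAlg.norm_of (1 : R⁰))).injective
    (injective_stableToCrossed R hxy)

variable (R) in
theorem surjective_toCorner : Function.Surjective (toCorner R) := by
  rintro ⟨_, d, rfl⟩
  obtain ⟨a, rfl⟩ := surjective_stableToCrossed R d
  obtain ⟨x, hx⟩ := StableAlg.of_one_mul_mul_of_one_mem_range a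
  refine ⟨x, Subtype.ext ?_⟩
  change toCrossed R x = projHat R * stableToCrossed R a * projHat R
  rw [← toCrossed_one, ← stableToCrossed_of_one, ← stableToCrossed_of_one, hx, map_mul, map_mul]

end Main

end

end RingCStar

theorem mainTheorem4_general (R : Type*) [CommRing R] [IsDomain R]
    [∀ m : R⁰, Finite (R ⧸ Ideal.span {(m : R)})] :
    ∃ (Φ : StableAlg R ≃⋆ₐ[ℂ] AdelicCrossedProduct R) (β : RingAlg R ≃⋆ₐ[ℂ] AdelicCorner R),
      (∀ n : R, (β (RingAlg.u n) : AdelicCrossedProduct R) = Vp (translationBy n)) ∧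
      (∀ m : R⁰, (β (RingAlg.s m) : AdelicCrossedProduct R) = Vp (dilationBy m)) ∧
      (∀ (k : R⁰) (x : RingAlg R), Φ (StableAlg.of k x) =
        Vp (dilationBy k)⁻¹ * (β x : AdelicCrossedProduct R) * star (Vp (dilationBy k)⁻¹)) :=
  ⟨StarAlgEquiv.ofBijective (stableToCrossed R)
      ⟨injective_stableToCrossed R, surjective_stableToCrossed R⟩,
    StarAlgEquiv.ofBijective (toCorner R) ⟨injective_toCorner R, surjective_toCorner R⟩,
    toCrossed_u, toCrossed_s, stableToCrossed_of⟩

theorem mainTheorem4 (R : Type*) [CommRing R] [IsDomain R] (hR : ¬ IsField R)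
    [∀ m : R⁰, Finite (R ⧸ Ideal.span {(m : R)})] :
    ∃ (Φ : StableAlg R ≃⋆ₐ[ℂ] AdelicCrossedProduct R) (β : RingAlg R ≃⋆ₐ[ℂ] AdelicCorner R),
      (∀ n : R, (β (RingAlg.u n) : AdelicCrossedProduct R) = Vp (translationBy n)) ∧
      (∀ m : R⁰, (β (RingAlg.s m) : AdelicCrossedProduct R) = Vp (dilationBy m)) ∧
      (∀ (k : R⁰) (x : RingAlg R), Φ (StableAlg.of k x) =
        Vp (dilationBy k)⁻¹ * (β x : AdelicCrossedProduct R) * star (Vp (dilationBy k)⁻¹)) :=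
  mainTheorem4_general R
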